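/- Let $G$ be a locally compact Hausdorff group with left Haar measure, let $X$ be a locally compact Hausdorff space and let $\nu$ be a regular $\sigma$-finite Borel measure on $X$. Let $\theta$ be a measurable action of $G$ on $(X,\nu)$: an action $(g,x)\mapsto \theta_g(x)=gx$ of $G$ on the set $X$ such that the map $G\times X\to X$, $(g,x)\mapsto gx$, is Borel measurable (for the Borel $\sigma$-algebra of the topological space $G \times X$) and such that $(\theta_g)_*\nu$ and $\nu$ are mutually absolutely continuous for every $g\in G$. The action is called (Zimmer-)amenable if there is an equivariant conditional expectation $\mathscr E: L_\infty(X)\,\overline{\otimes}\,L_\infty(G)\to L_\infty(X)$, that is, a unital, positivity preserving, $L_\infty(X)$-linear map such that $\mathscr E\big(f(g^{-1}\,\cdot\,,g^{-1}\,\cdot\,)\big)(x)=\mathscr E(f)(g^{-1}x)$ for all $g \in G$ and all $f$. Here $L_\infty(X)\,\overline{\otimes}\,L_\infty(G)$ is the dual space of $L_1(X;L_1(G))$. Let $\mathbb P_0(G)$ be the set of probability measures on $G$ that are absolutely continuous with respect to the Haar measure, regarded as a subset of $L_1(G)$. A Borel map $\mu:X\to\mathbb P_0(G)$, $x\mapsto\mu^x$,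 is understood to have norm separable range in $L_1(G)$ (which is automatic if $G$ is second countable); equivalently, $\mu$ is strongly measurable as an $L_1(G)$-valued map. Write $(g\mu^x)(A)=\mu^x(g^{-1}A)$ for the left translate of $\mu^x$. **Proposition.** The following are equivalent. 1. The action $\theta$ is amenable. 2. For every probability measure $m$ on $X$ that is absolutely continuous with respect to $\nu$, every $\varepsilon>0$ and every compact $K\subset G$ there is a Borel map $\mu:X\to\mathbb P_0(G)$ such that $$\sup_{g\in K}\int_X\|g\,\mu^x-\mu^{gx}\|_1\,dm(x)<\varepsilon .$$ 3. There is an asymptotically equivariant net of Borel maps, that is, a net $(\mu_\alpha)_\alpha$ of Borel maps $X\to\mathbb P_0(G)$ such that for every probability measure $m\ll\nu$ on $X$, every $\varepsilon>0$ and every compact $K\subset G$ there is an $\alpha_0$ with $\sup_{g\in K}\int_X\|g\,\mu_\alpha^x-\mu_\alpha^{gx}\|_1\,dm(x)<\varepsilon$ for all $\alpha\ge\alpha_0$. -/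

import Mathlib

open MeasureTheory
open scoped ENNReal

universe u v

namespace AmenableAction

/-- `θ : G → Aut(X, ν)`, `θ_g x = g • x`, is a measurable action: the map `(g, x) ↦ g • x` is
measurable for the Borel structure of the topological space `G × X`, and each `(θ_g)_* ν` is
mutually absolutely continuous with `ν`. -/
class IsMeasurableAction (G : Type v) {X : Type u} [Group G] [TopologicalSpace G]
    [TopologicalSpace X] [MeasurableSpace X] [MulAction G X] (ν : Measure X) : Prop where
  measurable_action : Measurable[borel (G × X)] (fun p : G × X => p.1 • p.2)
  map_absolutelyContinuous : ∀ g : G, ν.map (fun x => g • x) ≪ ν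
  absolutelyContinuous_map : ∀ g : G, ν ≪ ν.map (fun x => g • x)

noncomputable section

section Action

variable {X : Type u} {G : Type v} [Group G] [TopologicalSpace G] [TopologicalSpace X]
  [MeasurableSpace X] [BorelSpace X] [MulAction G X]

theorem measurable_smul_of_action (ν : Measure X) [h : IsMeasurableAction G ν] (g : G) :
    Measurable (fun x : X => g • x) := by
  have hc : Continuous (fun x : X => (g, x)) := by fun_prop
  have hm : Measurable[_, borel (G × X)] (fun x : X => (g, x)) := by
    borelize (G × X)
    exact hc.measurable
  exact h.measurable_action.comp hm

theorem quasi_of_action (ν : Measure X) [h : IsMeasurableAction G ν] (g : G) :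
    Measure.QuasiMeasurePreserving (fun x : X => g • x) ν ν :=
  ⟨measurable_smul_of_action ν g, h.map_absolutelyContinuous g⟩

/-- `x ↦ g • x` as a measurable equivalence. -/
def actionEquiv (ν : Measure X) [IsMeasurableAction G ν] (g : G) : X ≃ᵐ X where
  toEquiv := MulAction.toPerm g
  measurable_toFun := measurable_smul_of_action ν g
  measurable_invFun := measurable_smul_of_action ν g⁻¹

/-- The Radon-Nikodym derivative `d (θ_{g⁻¹})_* ν / d ν`. -/
def density (ν : Measure X) (g : G) (x : X) : ℝ≥0∞ :=
  (ν.map (fun y => g⁻¹ • y)).rnDeriv ν x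

theorem lintegral_density_mul (ν : Measure X) [SigmaFinite ν] [h : IsMeasurableAction G ν]
    (g : G) {f : X → ℝ≥0∞} (hf : AEMeasurable f ν) :
    ∫⁻ x, density ν g x * f (g • x) ∂ν = ∫⁻ x, f x ∂ν := by
  have : SigmaFinite (ν.map (fun y => g⁻¹ • y)) :=
    (actionEquiv ν g⁻¹).sigmaFinite_map
  have hf' : AEMeasurable (fun x => f (g • x)) ν :=
    hf.comp_quasiMeasurePreserving (quasi_of_action ν g)
  unfold density
  rw [lintegral_rnDeriv_mul (h.map_absolutelyContinuous g⁻¹) hf',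
    lintegral_map' (hf'.mono_ac (h.map_absolutelyContinuous g⁻¹))
      (measurable_smul_of_action ν g⁻¹).aemeasurable]
  simp

end Action

variable {X : Type u} {G : Type v} [Group G] [TopologicalSpace G] [IsTopologicalGroup G]
  [MeasurableSpace G] [BorelSpace G] [TopologicalSpace X] [MeasurableSpace X] [BorelSpace X]
  [MulAction G X]

/-- Left translation `(g f)(h) = f (g⁻¹ h)` on `L₁(G)`. -/
def leftTranslate (η : Measure G) [η.IsHaarMeasure] (g : G) : Lp ℝ 1 η →ₗᵢ[ℝ] Lp ℝ 1 η :=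
  Lp.compMeasurePreservingₗᵢ ℝ (fun h => g⁻¹ * h) (measurePreserving_mul_left η g⁻¹)

/-- `ℙ₀(G)`: the probability measures on `G` which are absolutely continuous with respect to the
Haar measure, identified with their densities in `L₁(G)`. -/
def ProbDensity (η : Measure G) : Set (Lp ℝ 1 η) :=
  {f | 0 ≤ f ∧ ∫ h, f h ∂η = 1}

/-! ### The algebra `L∞(X) ⊗̄ L∞(G)` -/

/-- The predual `L₁(X; L₁(G)) = L₁(X) ⊗̂ L₁(G)` of `L∞(X) ⊗̄ L∞(G)`. -/
abbrev TensorPredual (ν : Measure X) (η : Measure G) : Type (max u v) :=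
  Lp (Lp ℝ 1 η) 1 ν

/-- The (self-adjoint part of the) von Neumann algebra `L∞(X) ⊗̄ L∞(G)`, as the dual space of
its predual `L₁(X; L₁(G))`. A bounded measurable function `F` on `X × G` is the functional
`k ↦ ∫ x, ∫ h, F (x, h) * k x h ∂η ∂ν`. This form of `L∞(X × G)` is the correct one for every
locally compact group, also when the Haar measure is not `σ`-finite. -/
abbrev LinftyTensor (ν : Measure X) (η : Measure G) : Type (max u v) :=
  StrongDual ℝ (TensorPredual ν η)

/-- Positivity in `L∞(X) ⊗̄ L∞(G)`. -/
def TensorNonneg {ν : Measure X} {η : Measure G} (F : LinftyTensor ν η) : Prop :=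
  ∀ k : TensorPredual ν η, 0 ≤ k → 0 ≤ F k

/-- The unit of `L∞(X) ⊗̄ L∞(G)`: the functional `k ↦ ∫ x, ∫ h, k x h ∂η ∂ν`. -/
def tensorOne (ν : Measure X) (η : Measure G) : LinftyTensor ν η :=
  (L1.integralCLM (μ := η) (E := ℝ)).comp (L1.integralCLM (μ := ν) (E := Lp ℝ 1 η))

/-- The product `(a F)(x, h) = a(x) F(x, h)` for `a ∈ L∞(X)`, that is `(a F)(k) = F(a k)`. -/
def tensorMul {ν : Measure X} {η : Measure G} (a : Lp ℝ ∞ ν) (F : LinftyTensor ν η) :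
    LinftyTensor ν η :=
  F.comp ((ContinuousLinearMap.lsmul ℝ ℝ (E := Lp ℝ 1 η)).holderL ν ∞ 1 1 a)

/-- The function `x ↦ (d (θ_{g⁻¹})_* ν / d ν)(x) g⁻¹ k(g x)`, with values in `L₁(G)`. -/
def predualFun (ν : Measure X) (η : Measure G) [η.IsHaarMeasure] (g : G)
    (k : X → Lp ℝ 1 η) (x : X) : Lp ℝ 1 η :=
  (density ν g x).toReal • leftTranslate η g⁻¹ (k (g • x))

section Translation

variable (ν : Measure X) [SigmaFinite ν] [IsMeasurableAction G ν]
  (η : Measure G) [η.IsHaarMeasure]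

theorem eLpNorm_predualFun_le (g : G) {k : X → Lp ℝ 1 η} (hk : AEStronglyMeasurable k ν) :
    eLpNorm (predualFun ν η g k) 1 ν ≤ eLpNorm k 1 ν := by
  rw [eLpNorm_one_eq_lintegral_enorm, eLpNorm_one_eq_lintegral_enorm,
    ← lintegral_density_mul ν g hk.enorm]
  refine lintegral_mono fun x => ?_
  have h1 : ‖leftTranslate η g⁻¹ (k (g • x))‖ₑ = ‖k (g • x)‖ₑ := by
    rw [← ofReal_norm, LinearIsometry.norm_map, ofReal_norm]
  simp only [predualFun, enorm_smul, h1]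
  gcongr
  rw [Real.enorm_of_nonneg ENNReal.toReal_nonneg]
  exact ENNReal.ofReal_toReal_le

theorem memLp_predualFun (g : G) {k : X → Lp ℝ 1 η} (hk : MemLp k 1 ν) :
    MemLp (predualFun ν η g k) 1 ν := by
  refine ⟨?_, (eLpNorm_predualFun_le ν η g hk.1).trans_lt hk.2⟩
  have h1 : AEStronglyMeasurable (fun x => k (g • x)) ν :=
    hk.1.comp_quasiMeasurePreserving (quasi_of_action ν g)
  have h2 : AEStronglyMeasurable (fun x => (density ν g x).toReal) ν :=
    (Measure.measurable_rnDeriv _ _).ennreal_toReal.aestronglyMeasurable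
  exact h2.smul ((leftTranslate η g⁻¹).continuous.comp_aestronglyMeasurable h1)

/-- The isometric action of `g⁻¹` on `L₁(X; L₁(G))`, whose adjoint is the translation
`F ↦ F(g⁻¹ x, g⁻¹ h)` of `L∞(X) ⊗̄ L∞(G)`:
`∫ F(g⁻¹ x, g⁻¹ h) k(x, h) dη dν = ∫ F(x, h) k(g x, g h) dη d(θ_{g⁻¹})_* ν`. -/
def predualTranslate (g : G) : TensorPredual ν η →L[ℝ] TensorPredual ν η :=
  LinearMap.mkContinuous
    { toFun := fun k => (memLp_predualFun ν η g (Lp.memLp k)).toLp _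
      map_add' := fun k l => by
        rw [← MemLp.toLp_add]
        refine MemLp.toLp_congr _ _ ?_
        filter_upwards [(quasi_of_action ν g).ae (Lp.coeFn_add k l)] with x hx
        rw [Pi.add_apply] at hx
        simp only [predualFun, Pi.add_apply]
        rw [hx, map_add, smul_add]
      map_smul' := fun c k => by
        rw [RingHom.id_apply, ← MemLp.toLp_const_smul]
        refine MemLp.toLp_congr _ _ ?_
        filter_upwards [(quasi_of_action ν g).ae (Lp.coeFn_smul c k)] with x hx
        rw [Pi.smul_apply] at hx
        simp only [predualFun, Pi.smul_apply]
        rw [hx, map_smul, smul_comm c] }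
    1
    (fun k => by
      rw [one_mul]
      change ‖(memLp_predualFun ν η g (Lp.memLp k)).toLp _‖ ≤ _
      rw [Lp.norm_toLp, Lp.norm_def]
      exact ENNReal.toReal_mono (Lp.eLpNorm_ne_top k)
        (eLpNorm_predualFun_le ν η g (Lp.memLp k).1))

theorem predualTranslate_coeFn (g : G) (k : TensorPredual ν η) :
    predualTranslate ν η g k =ᵐ[ν] predualFun ν η g k :=
  MemLp.coeFn_toLp (memLp_predualFun ν η g (Lp.memLp k))

/-- The translation `(g F)(x, h) = F(g⁻¹ x, g⁻¹ h)` on `L∞(X) ⊗̄ L∞(G)`. -/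
def tensorTranslate (g : G) (F : LinftyTensor ν η) : LinftyTensor ν η :=
  F.comp (predualTranslate ν η g)

/-- `E : L∞(X) ⊗̄ L∞(G) → L∞(X)` is a `θ`-equivariant conditional expectation: a unital,
positivity preserving, `L∞(X)`-linear map with `E(g F) = θ_g(E F)`, `θ_g f(x) = f(g⁻¹ x)`. -/
structure IsEquivariantCondExp (E : LinftyTensor ν η →ₗ[ℝ] Lp ℝ ∞ ν) : Prop where
  unital : E (tensorOne ν η) =ᵐ[ν] fun _ => 1
  nonneg : ∀ F, TensorNonneg F → 0 ≤ E F
  linear : ∀ (a : Lp ℝ ∞ ν) (F : LinftyTensor ν η),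
    E (tensorMul a F) =ᵐ[ν] fun x => a x * E F x
  equivariant : ∀ (g : G) (F : LinftyTensor ν η),
    E (tensorTranslate ν η g F) =ᵐ[ν] fun x => E F (g⁻¹ • x)

/-- (Zimmer) amenability of the action of `G` on `(X, ν)`. -/
def IsAmenable : Prop :=
  ∃ E : LinftyTensor ν η →ₗ[ℝ] Lp ℝ ∞ ν, IsEquivariantCondExp ν η E

end Translation

/-! ### Approximately equivariant Borel maps -/

/-- A Borel map `μ : X → ℙ₀(G)`, `x ↦ μ^x`, that is, a strongly measurable (Borel with separable
range) map into `L₁(G)` with values in `ℙ₀(G)`. On norm separable subsets of `L₁(G)` the Borel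
structures of the norm and of `σ(M(G), C₀(G))` agree, and if `G` is second countable, then
`L₁(G)` is separable. -/
structure IsBorelMap (η : Measure G) (μ : X → Lp ℝ 1 η) : Prop where
  stronglyMeasurable : StronglyMeasurable μ
  mem : ∀ x, μ x ∈ ProbDensity η

/-- `sup_{g ∈ K} ∫_X ‖g μ^x - μ^{g x}‖₁ dm(x)`. -/
def defect (η : Measure G) [η.IsHaarMeasure] (m : Measure X) (K : Set G)
    (μ : X → Lp ℝ 1 η) : ℝ≥0∞ :=
  ⨆ g ∈ K, ∫⁻ x, ‖leftTranslate η g (μ x) - μ (g • x)‖ₑ ∂m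

/-- Asymptotic equivariance of a net `(μ_i)` of Borel maps: for all `m`, `ε` and `K`, the
defect of `μ_i` is less than `ε` for all large `i`. -/
def AsymptoticallyEquivariant (ν : Measure X) (η : Measure G) [η.IsHaarMeasure]
    {ι : Type*} [Preorder ι] (μ : ι → X → Lp ℝ 1 η) : Prop :=
  ∀ m : Measure X, IsProbabilityMeasure m → m ≪ ν → ∀ ε : ℝ, 0 < ε → ∀ K : Set G, IsCompact K →
    ∃ i₀, ∀ i, i₀ ≤ i → defect η m K (μ i) < ENNReal.ofReal ε

end

end AmenableAction

namespace AmenableAction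

noncomputable section

open Set Filter Topology
open scoped Pointwise

set_option linter.unusedSectionVars false

/-! ### Products of Radon measures on the Borel sets of a product space -/

-- A Borel map `μ` into `ℙ₀(G)` is the same thing as the contraction `M : l ↦ l μ` from `L₁(X)` to
-- `L₁(X; L₁(G))`, which is positive, `L∞(X)`-linear and a right inverse of the integral over the
-- fibres. Let `U` and `P` be the isometric representations of `G` on these two spaces (`translate`,
-- `predualRep`). Then `P(g) M l - M U(g) l` has norm `∫ |l(x)| ‖g μ^x - μ^{gx}‖ dν(x)`
-- (`enorm_predualRep_borelMul_sub`), so asymptotic equivariance of Borel maps says that the `M`'s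
-- asymptotically intertwine `U` and `P`.
--
-- A net of Borel maps gives a conditional expectation by duality: `⟨E F, l⟩` is the limit of `F(M_i
-- l)` along an ultrafilter (`exists_ultrafilter_limit`), and the properties of the `M_i` pass to
-- the limit.
--
-- Conversely, let `E` be given and let `k ≥ 0` be in `L₁(X)`. The functional `F ↦ ⟨E F, k⟩` lies in
-- the bidual of `L₁(X; L₁(G))`. The positive cone is convex, so Hahn-Banach separation replaces
-- this functional by positive elements `ζ`, with norm approximation of finitely many equivariance
-- conditions and of the fibre integral `k` (`exists_nonneg_approx`). Normalising `ζ` in the fibres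
-- gives a Borel map (`exists_borelMul_fiberIntegral_eq`). This controls finitely many `g` and `l`.
-- To reach compact sets, `M` is replaced by the average of `P(h) M U(h)⁻¹` against a function in
-- `C_c(G)`; averages against functions of integral zero tend to zero
-- (`eventually_norm_integral_smul_twist_le`), and this makes the averaged maps equivariant
-- uniformly on compact sets. By `exists_eq_borelMul` the averaged map comes from a Borel map again.
--
-- The averaging needs `U` and `P` to be strongly continuous, although the action is only Borel and
-- `G` need not be second countable. The densities of the averages `∫_A h_* m dη(h)` have continuous
-- orbits because `η(gA ∆ A) → 0`. If `b` in `L∞(X)` annihilates all of them, then `b(gx) = 0` for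
-- almost all `x`, for almost all `g` in a compact neighbourhood of 1, so `b = 0`. Since `(g, x) ↦
-- b(gx)` is measurable only for the Borel sets of the topological product, which can exceed the
-- product `σ`-algebra, this rests on a product measure on that larger `σ`-algebra and on its
-- approximation by boxes (`withDensity_borelProd_eq`).

/-- The product `A × X`, with the Borel `σ`-algebra of the product topology. -/
def BorelProd (A : Type*) (X : Type*) : Type _ := A × X

section BorelProd

variable {A X : Type*} [TopologicalSpace A] [TopologicalSpace X]

instance : TopologicalSpace (BorelProd A X) := inferInstanceAs (TopologicalSpace (A × X))

instance : MeasurableSpace (BorelProd A X) := borel (A × X)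

instance : BorelSpace (BorelProd A X) := ⟨rfl⟩

/-- The pair `(a, x)` as a point of `BorelProd A X`. -/
def BorelProd.mk (a : A) (x : X) : BorelProd A X := (a, x)

theorem BorelProd.continuous_mk_right (a : A) : Continuous (BorelProd.mk a : X → BorelProd A X) :=
  Continuous.prodMk_right a

/-- The identity map to the product with its product `σ`-algebra. -/
def BorelProd.toProd (p : BorelProd A X) : A × X := p

theorem BorelProd.continuous_toProd :
    Continuous (BorelProd.toProd : BorelProd A X → A × X) := continuous_id (X := A × X)

/-- A compact subset of the section of an open set is contained in the section of an open box. -/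
theorem exists_box_of_isCompact_section {U : Set (BorelProd A X)} (hU : IsOpen U) {a : A}
    {D : Set X} (hD : IsCompact D) (hDU : D ⊆ BorelProd.mk a ⁻¹' U) :
    ∃ (V : Set A) (W : Set X), IsOpen V ∧ IsOpen W ∧ a ∈ V ∧ D ⊆ W ∧
      BorelProd.toProd ⁻¹' (V ×ˢ W) ⊆ U := by
  obtain ⟨V, W, hV, hW, haV, hDW, hVW⟩ :=
    generalized_tube_lemma (isCompact_singleton (x := a)) hD (n := U) hU (by
      rintro ⟨a', x⟩ ⟨ha, hx⟩
      obtain rfl : a' = a := ha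
      exact hDU hx)
  exact ⟨V, W, hV, hW, haV rfl, hDW, hVW⟩

variable [MeasurableSpace X] [BorelSpace X]

theorem BorelProd.measurable_mk_right (a : A) :
    Measurable (BorelProd.mk a : X → BorelProd A X) :=
  (BorelProd.continuous_mk_right a).measurable

variable (m : Measure X) [m.InnerRegular]

/-- A compact part of one section, of measure larger than `r`, stays inside all nearby sections by
the tube lemma. -/
theorem lowerSemicontinuous_measure_section {U : Set (BorelProd A X)} (hU : IsOpen U) :
    LowerSemicontinuous fun a : A => m (BorelProd.mk a ⁻¹' U) := by
  intro a r hr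
  obtain ⟨D, hDU, hD, hrD⟩ := (hU.preimage (BorelProd.continuous_mk_right a)).measurableSet
    |>.exists_lt_isCompact hr
  obtain ⟨V, W, hV, -, haV, hDW, hVW⟩ := exists_box_of_isCompact_section hU hD hDU
  filter_upwards [hV.mem_nhds haV] with a' ha'
  exact hrD.trans_le (measure_mono fun x hx => hVW ⟨ha', hDW hx⟩)

variable [IsFiniteMeasure m] [MeasurableSpace A] [BorelSpace A]

/-- The topological Borel structure is finer than the product structure. -/
theorem BorelProd.measurable_toProd :
    Measurable (BorelProd.toProd : BorelProd A X → A × X) := by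
  have h1 : Continuous fun p : BorelProd A X => p.toProd.1 :=
    continuous_fst.comp BorelProd.continuous_toProd
  have h2 : Continuous fun p : BorelProd A X => p.toProd.2 :=
    continuous_snd.comp BorelProd.continuous_toProd
  exact h1.measurable.prodMk h2.measurable

/-- Open sets form a `π`-system generating the Borel sets of the product, and lower semicontinuity
handles them; finiteness of `m` is used for complements. -/
theorem measurable_measure_section {S : Set (BorelProd A X)} (hS : MeasurableSet S) :
    Measurable fun a : A => m (BorelProd.mk a ⁻¹' S) := by
  induction S, hS using MeasurableSpace.induction_on_inter
    (BorelSpace.measurable_eq (α := BorelProd A X)) isPiSystem_isOpen with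
  | empty => simp
  | basic U hU => exact (lowerSemicontinuous_measure_section m hU).measurable
  | compl S hS ih =>
    have : ∀ a : A, m (BorelProd.mk a ⁻¹' Sᶜ) = m univ - m (BorelProd.mk a ⁻¹' S) := fun a => by
      rw [preimage_compl, measure_compl (BorelProd.measurable_mk_right a hS) (measure_ne_top _ _)]
    simp_rw [this]
    exact measurable_const.sub ih
  | iUnion f hd hf ih =>
    have : ∀ a : A, m (BorelProd.mk a ⁻¹' ⋃ i, f i) = ∑' i, m (BorelProd.mk a ⁻¹' f i) :=
      fun a => by
        rw [preimage_iUnion, measure_iUnion (fun i j hij => (hd hij).preimage _)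
          (fun i => BorelProd.measurable_mk_right a (hf i))]
    simp_rw [this]
    exact Measurable.tsum ih

theorem measurable_map_mk :
    Measurable fun a : A => m.map (BorelProd.mk a : X → BorelProd A X) := by
  refine Measure.measurable_of_measurable_coe _ fun S hS => ?_
  simp_rw [Measure.map_apply (BorelProd.measurable_mk_right _) hS]
  exact measurable_measure_section m hS

/-- The product of `κ` and `m` on the Borel sets of the topological space `A × X`. -/
def borelProd (κ : Measure A) : Measure (BorelProd A X) :=
  κ.bind fun a => m.map (BorelProd.mk a)

variable (κ : Measure A)

theorem lintegral_borelProd {f : BorelProd A X → ℝ≥0∞} (hf : Measurable f) :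
    ∫⁻ p, f p ∂borelProd m κ = ∫⁻ a, ∫⁻ x, f (BorelProd.mk a x) ∂m ∂κ := by
  rw [borelProd, Measure.lintegral_bind (measurable_map_mk m).aemeasurable hf.aemeasurable]
  simp_rw [lintegral_map hf (BorelProd.measurable_mk_right _)]

theorem measurable_lintegral_mk {f : BorelProd A X → ℝ≥0∞} (hf : Measurable f) :
    Measurable fun a => ∫⁻ x, f (BorelProd.mk a x) ∂m := by
  have := (Measure.measurable_lintegral hf).comp (measurable_map_mk (A := A) m)
  simpa only [Function.comp_def, lintegral_map hf (BorelProd.measurable_mk_right _)] using this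

theorem borelProd_apply {S : Set (BorelProd A X)} (hS : MeasurableSet S) :
    borelProd m κ S = ∫⁻ a, m (BorelProd.mk a ⁻¹' S) ∂κ := by
  rw [borelProd, Measure.bind_apply hS (measurable_map_mk m).aemeasurable]
  simp_rw [Measure.map_apply (BorelProd.measurable_mk_right _) hS]

instance [IsFiniteMeasure κ] : IsFiniteMeasure (borelProd m κ) := by
  refine ⟨?_⟩
  rw [borelProd_apply m κ MeasurableSet.univ]
  simpa using ENNReal.mul_lt_top (measure_lt_top m _) (measure_lt_top κ _)

/-- Inside an open set, a finite union of open boxes has almost full measure. -/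
theorem exists_isOpen_measurableSet_borelProd_le [IsFiniteMeasure κ] [κ.WeaklyRegular] {C : Set A}
    (hC : IsCompact C) (hκC : κ Cᶜ = 0) {U : Set (BorelProd A X)} (hU : IsOpen U) {ε : ℝ≥0∞}
    (hε : ε ≠ 0) :
    ∃ R : Set (A × X), BorelProd.toProd ⁻¹' R ⊆ U ∧ MeasurableSet R ∧
      borelProd m κ U ≤ borelProd m κ (BorelProd.toProd ⁻¹' R) + ε := by
  have hfin : ∀ a : A, m (BorelProd.mk a ⁻¹' U) ≠ ∞ := fun a => measure_ne_top _ _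
  have hε2 : ε / 2 ≠ 0 := (ENNReal.half_pos hε).ne'
  -- Vitali-Carathéodory: an upper semicontinuous minorant `g` of the section measures loses only `ε
  -- / 2` in the integral. Upper semicontinuity lets a bound on `g` at one point persist on a
  -- neighbourhood.
  obtain ⟨g, hgf, hg, hint⟩ := exists_upperSemicontinuous_le_lintegral_le (μ := κ)
    (fun a => (m (BorelProd.mk a ⁻¹' U)).toNNReal) (by
      simp_rw [ENNReal.coe_toNNReal (hfin _), ← borelProd_apply m κ hU.measurableSet]
      exact measure_ne_top _ _) hε2
  simp_rw [ENNReal.coe_toNNReal (hfin _), ← borelProd_apply m κ hU.measurableSet] at hint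
  obtain ⟨δ, hδ, hδε⟩ : ∃ δ : ℝ≥0∞, δ ≠ 0 ∧ δ * κ univ ≤ ε / 2 := by
    obtain ⟨δ, hδ, h⟩ := ENNReal.exists_nnreal_pos_mul_lt (measure_ne_top κ univ) hε2
    exact ⟨δ, by exact_mod_cast hδ.ne', h.le⟩
  have key : ∀ a : A, ∃ (V : Set A) (W : Set X), IsOpen V ∧ IsOpen W ∧ a ∈ V ∧
      BorelProd.toProd ⁻¹' (V ×ˢ W) ⊆ U ∧ ∀ a' ∈ V, (g a' : ℝ≥0∞) ≤ m W + δ := by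
    intro a
    obtain ⟨D, hDU, hD, hgD⟩ : ∃ D ⊆ BorelProd.mk a ⁻¹' U, IsCompact D ∧
        (g a : ℝ≥0∞) < m D + δ := by
      by_cases h0 : g a = 0
      · exact ⟨∅, empty_subset _, isCompact_empty, by simpa [h0] using pos_iff_ne_zero.2 hδ⟩
      · have h1 : (g a : ℝ≥0∞) ≤ m (BorelProd.mk a ⁻¹' U) := by
          rw [← ENNReal.coe_toNNReal (hfin a)]; exact_mod_cast hgf a
        have h2 : (g a : ℝ≥0∞) - δ < m (BorelProd.mk a ⁻¹' U) :=
          (ENNReal.sub_lt_self ENNReal.coe_ne_top (by exact_mod_cast h0) hδ).trans_le h1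
        obtain ⟨D, hDU, hD, hrD⟩ :=
          (hU.preimage (BorelProd.continuous_mk_right a)).measurableSet.exists_lt_isCompact h2
        exact ⟨D, hDU, hD, by
          rw [add_comm]; exact ENNReal.lt_add_of_sub_lt_left (Or.inl ENNReal.coe_ne_top) hrD⟩
    obtain ⟨V, W, hV, hW, haV, hDW, hVW⟩ := exists_box_of_isCompact_section hU hD hDU
    have h3 : (g a : ℝ≥0∞) < m W + δ := hgD.trans_le (by gcongr)
    obtain ⟨r, hgr, hrW⟩ := ENNReal.lt_iff_exists_nnreal_btwn.1 h3
    have h4 := hg a r (by exact_mod_cast hgr)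
    obtain ⟨V', hV', hV'o, haV'⟩ := eventually_nhds_iff.1 h4
    refine ⟨V ∩ V', W, hV.inter hV'o, hW, ⟨haV, haV'⟩,
      fun p hp => hVW ⟨hp.1.1, hp.2⟩, fun a' ha' => ?_⟩
    exact le_trans (by exact_mod_cast (hV' a' ha'.2).le) hrW.le
  choose V W hV hW haV hVW hgW using key
  -- Over a point of `V i` the section of the union contains `W i`, so its measure is at least `g -
  -- δ`. Finitely many of the sets `V i` cover `C`, which carries `κ`.
  obtain ⟨t, ht⟩ := hC.elim_finite_subcover V hV fun a _ => mem_iUnion.2 ⟨a, haV a⟩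
  have hRm : MeasurableSet (⋃ i ∈ t, V i ×ˢ W i) :=
    Finset.measurableSet_biUnion _ fun i _ => (hV i).measurableSet.prod (hW i).measurableSet
  refine ⟨⋃ i ∈ t, V i ×ˢ W i, by simpa using fun i _ => hVW i, hRm, ?_⟩
  rw [borelProd_apply m κ (BorelProd.measurable_toProd hRm)]
  refine hint.trans ?_
  refine le_trans (add_le_add_left ?_ _) (by rw [add_assoc, ENNReal.add_halves])
  calc ∫⁻ a, (g a : ℝ≥0∞) ∂κ
      ≤ ∫⁻ a, (m (BorelProd.mk a ⁻¹' (BorelProd.toProd ⁻¹' ⋃ i ∈ t, V i ×ˢ W i)) + δ) ∂κ := by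
        refine lintegral_mono_ae ?_
        have hCae : ∀ᵐ a ∂κ, a ∈ C := hκC
        filter_upwards [hCae] with a ha
        obtain ⟨i, hi, hai⟩ := mem_iUnion₂.1 (ht ha)
        refine (hgW i a hai).trans ?_
        gcongr
        exact fun x hx => mem_iUnion₂.2 ⟨i, hi, hai, hx⟩
    _ ≤ _ := by
        rw [lintegral_add_right _ measurable_const, lintegral_const]
        exact add_le_add_right hδε _

/-- Bounded Borel functions on `A × X` with the same integrals over measurable boxes have the same
integrals over Borel sets. -/
theorem withDensity_borelProd_eq [IsFiniteMeasure κ] [κ.WeaklyRegular] {C : Set A}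
    (hC : IsCompact C) (hκC : κ Cᶜ = 0) {u w : BorelProd A X → ℝ≥0∞} (hu : Measurable u)
    (hw : Measurable w) {c : ℝ≥0∞} (hc : c ≠ ∞) (huc : ∀ p, u p ≤ c) (hwc : ∀ p, w p ≤ c)
    (h : ∀ (S : Set A) (T : Set X), MeasurableSet S → MeasurableSet T →
      ∫⁻ a in S, ∫⁻ x in T, u (BorelProd.mk a x) ∂m ∂κ
        = ∫⁻ a in S, ∫⁻ x in T, w (BorelProd.mk a x) ∂m ∂κ) :
    (borelProd m κ).withDensity u = (borelProd m κ).withDensity w := by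
  have hbox : ∀ (f : BorelProd A X → ℝ≥0∞), Measurable f → ∀ (S : Set A) (T : Set X),
      MeasurableSet S → MeasurableSet T →
      (borelProd m κ).withDensity f (BorelProd.toProd ⁻¹' (S ×ˢ T))
        = ∫⁻ a in S, ∫⁻ x in T, f (BorelProd.mk a x) ∂m ∂κ := by
    intro f hf S T hS hT
    have hST : MeasurableSet (BorelProd.toProd ⁻¹' (S ×ˢ T) : Set (BorelProd A X)) :=
      BorelProd.measurable_toProd (hS.prod hT)
    rw [withDensity_apply _ hST, ← lintegral_indicator hST,
      lintegral_borelProd m κ (hf.indicator hST), ← lintegral_indicator hS]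
    congr 1 with a
    by_cases ha : a ∈ S
    · rw [indicator_of_mem ha, ← lintegral_indicator hT]
      congr 1 with x
      by_cases hx : x ∈ T
      · rw [indicator_of_mem hx, indicator_of_mem]; exact ⟨ha, hx⟩
      · rw [indicator_of_notMem hx, indicator_of_notMem]; exact fun h => hx h.2
    · rw [indicator_of_notMem ha]
      rw [← lintegral_zero (μ := m)]
      congr 1 with x
      rw [indicator_of_notMem]; exact fun h => ha h.1
  have hfinite : ∀ f : BorelProd A X → ℝ≥0∞, (∀ p, f p ≤ c) →
      ∀ S : Set (BorelProd A X), MeasurableSet S →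
      (borelProd m κ).withDensity f S ≤ c * borelProd m κ S := by
    intro f hf S hS
    rw [withDensity_apply _ hS]
    exact (lintegral_mono fun p => hf p).trans_eq (by simp)
  have hfin : ∀ f : BorelProd A X → ℝ≥0∞, (∀ p, f p ≤ c) →
      IsFiniteMeasure ((borelProd m κ).withDensity f) := fun f hf =>
    ⟨(hfinite f hf univ MeasurableSet.univ).trans_lt
      (ENNReal.mul_lt_top hc.lt_top (measure_lt_top _ _))⟩
  have := hfin u huc
  have := hfin w hwc
  have hprod : ∀ R : Set (A × X), MeasurableSet R →
      (borelProd m κ).withDensity u (BorelProd.toProd ⁻¹' R)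
        = (borelProd m κ).withDensity w (BorelProd.toProd ⁻¹' R) := by
    have h1 : ((borelProd m κ).withDensity u).map BorelProd.toProd
        = ((borelProd m κ).withDensity w).map BorelProd.toProd := by
      refine Measure.ext_prod fun {S T} hS hT => ?_
      rw [Measure.map_apply BorelProd.measurable_toProd (hS.prod hT),
        Measure.map_apply BorelProd.measurable_toProd (hS.prod hT)]
      exact (hbox u hu S T hS hT).trans ((h S T hS hT).trans (hbox w hw S T hS hT).symm)
    intro R hR
    have h2 := congrArg (fun ρ => ρ R) h1
    simp only [Measure.map_apply BorelProd.measurable_toProd hR] at h2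
    exact h2
  -- The densities are bounded by `c`, so the part of an open set missed by a set of the product
  -- `σ`-algebra costs at most `c * δ`. Only an inequality is needed, since the roles of the two
  -- functions can be exchanged.
  have hopen : ∀ f₁ f₂ : BorelProd A X → ℝ≥0∞, (∀ p, f₁ p ≤ c) →
      (∀ R : Set (A × X), MeasurableSet R →
      (borelProd m κ).withDensity f₁ (BorelProd.toProd ⁻¹' R)
        = (borelProd m κ).withDensity f₂ (BorelProd.toProd ⁻¹' R)) →
      ∀ U : Set (BorelProd A X), IsOpen U →
      (borelProd m κ).withDensity f₁ U ≤ (borelProd m κ).withDensity f₂ U := by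
    intro f₁ f₂ hf₁ hf U hU
    refine ENNReal.le_of_forall_pos_le_add fun ε hε _ => ?_
    obtain ⟨δ, hδ, hδε⟩ := ENNReal.exists_nnreal_pos_mul_lt hc
      (b := (ε : ℝ≥0∞)) (by exact_mod_cast hε.ne')
    obtain ⟨R, hRU, hR, hle⟩ := exists_isOpen_measurableSet_borelProd_le m κ hC hκC hU
      (ε := (δ : ℝ≥0∞)) (by exact_mod_cast hδ.ne')
    have hRm : MeasurableSet (BorelProd.toProd ⁻¹' R : Set (BorelProd A X)) := BorelProd.measurable_toProd hR
    have hdiff : borelProd m κ (U \ BorelProd.toProd ⁻¹' R) ≤ δ := by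
      rw [measure_sdiff hRU hRm.nullMeasurableSet (measure_ne_top _ _)]
      exact tsub_le_iff_left.2 hle
    calc (borelProd m κ).withDensity f₁ U
        ≤ (borelProd m κ).withDensity f₁ (BorelProd.toProd ⁻¹' R) + (borelProd m κ).withDensity f₁ (U \ BorelProd.toProd ⁻¹' R) := by
          refine (measure_mono ?_).trans (measure_union_le _ _)
          rw [union_sdiff_cancel hRU]
      _ ≤ (borelProd m κ).withDensity f₂ U + ε := by
          refine add_le_add ((hf R hR).trans_le (measure_mono hRU)) ?_
          refine (hfinite f₁ hf₁ _ (hU.measurableSet.diff hRm)).trans ?_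
          rw [mul_comm]
          exact (mul_le_mul_left hdiff c).trans hδε.le
  refine ext_of_generate_finite _ (BorelSpace.measurable_eq (α := BorelProd A X))
    isPiSystem_isOpen (fun U hU => ?_) ?_
  · exact le_antisymm (hopen u w huc hprod U hU)
      (hopen w u hwc (fun R hR => (hprod R hR).symm) U hU)
  · exact hprod univ MeasurableSet.univ

end BorelProd

/-! ### The dual of `L₁` -/

section Dual

variable {X : Type*} [MeasurableSpace X] (ν : Measure X)

/-- The pairing of `L∞` and `L₁`. -/
def pairing : Lp ℝ ∞ ν →L[ℝ] Lp ℝ 1 ν →L[ℝ] ℝ :=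
  ContinuousLinearMap.lpPairing ν ∞ 1 (ContinuousLinearMap.mul ℝ ℝ)

variable {ν}

theorem ae_norm_le_norm_Lp_top (b : Lp ℝ ∞ ν) : ∀ᵐ x ∂ν, ‖b x‖ ≤ ‖b‖ := by
  filter_upwards [ae_le_eLpNormEssSup (f := b)] with x hx
  rw [Lp.norm_def, eLpNorm_exponent_top, ← toReal_enorm]
  exact ENNReal.toReal_mono (by simpa using Lp.eLpNorm_ne_top b) hx

theorem pairing_apply (b : Lp ℝ ∞ ν) (l : Lp ℝ 1 ν) : pairing ν b l = ∫ x, b x * l x ∂ν := by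
  simp [pairing, ContinuousLinearMap.lpPairing_eq_integral]

theorem integrable_mul_of_Lp (b : Lp ℝ ∞ ν) (l : Lp ℝ 1 ν) :
    Integrable (fun x => b x * l x) ν := by
  have h : MemLp (fun x => b x * l x) 1 ν := (Lp.memLp l).mul (Lp.memLp b)
  exact memLp_one_iff_integrable.1 h

theorem setIntegral_eq_pairing {s : Set X} (hs : MeasurableSet s) (hνs : ν s ≠ ∞)
    (b : Lp ℝ ∞ ν) : ∫ x in s, b x ∂ν = pairing ν b (indicatorConstLp 1 hs hνs 1) := by
  rw [pairing_apply, ← integral_indicator hs]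
  refine integral_congr_ae ?_
  filter_upwards [indicatorConstLp_coeFn (p := 1) (hs := hs) (hμs := hνs) (c := (1 : ℝ))] with x hx
  rw [hx]
  by_cases h : x ∈ s <;> simp [h]

theorem integrableOn_of_Lp_top (b : Lp ℝ ∞ ν) {s : Set X} (hs : MeasurableSet s)
    (hνs : ν s ≠ ∞) : IntegrableOn b s ν := by
  have := integrable_mul_of_Lp b (indicatorConstLp 1 hs hνs 1)
  rw [← integrable_indicator_iff hs]
  refine this.congr ?_
  filter_upwards [indicatorConstLp_coeFn (p := 1) (hs := hs) (hμs := hνs) (c := (1 : ℝ))] with x hx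
  rw [hx]
  by_cases h : x ∈ s <;> simp [h]

theorem ext_of_pairing [SigmaFinite ν] {b c : Lp ℝ ∞ ν}
    (h : ∀ l, pairing ν b l = pairing ν c l) : b = c := by
  refine Lp.ext (ae_eq_of_forall_setIntegral_eq_of_sigmaFinite
    (fun s hs hνs => integrableOn_of_Lp_top b hs hνs.ne)
    (fun s hs hνs => integrableOn_of_Lp_top c hs hνs.ne) ?_)
  intro s hs hνs
  rw [setIntegral_eq_pairing hs hνs.ne, setIntegral_eq_pairing hs hνs.ne, h]

theorem nonneg_of_pairing [SigmaFinite ν] {b : Lp ℝ ∞ ν}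
    (h : ∀ l, 0 ≤ l → 0 ≤ pairing ν b l) : 0 ≤ b := by
  rw [← Lp.coeFn_nonneg]
  refine ae_nonneg_of_forall_setIntegral_nonneg_of_sigmaFinite
    (fun s hs hνs => integrableOn_of_Lp_top b hs hνs.ne) ?_
  intro s hs hνs
  rw [setIntegral_eq_pairing hs hνs.ne]
  refine h _ ?_
  rw [← Lp.coeFn_nonneg]
  filter_upwards [indicatorConstLp_coeFn (p := 1) (hs := hs) (hμs := hνs.ne) (c := (1 : ℝ))]
    with x hx
  rw [hx]
  exact indicator_nonneg (fun _ _ => zero_le_one) x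

theorem pairing_nonneg {b : Lp ℝ ∞ ν} {l : Lp ℝ 1 ν} (hb : 0 ≤ b) (hl : 0 ≤ l) :
    0 ≤ pairing ν b l := by
  rw [pairing_apply]
  refine integral_nonneg_of_ae ?_
  filter_upwards [(Lp.coeFn_nonneg b).2 hb, (Lp.coeFn_nonneg l).2 hl] with x h1 h2
  exact mul_nonneg h1 h2

/-- For finite `ν` the functional restricts to the Hilbert space `L₂ ⊂ L₁`, where Riesz represents
it by some `w`. Testing on indicators bounds the integral of `±w` over `s` by `‖φ‖ ν(s)`, hence `|w|
≤ ‖φ‖` almost everywhere. -/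
theorem exists_pairing_eq_of_isFiniteMeasure [IsFiniteMeasure ν] (φ : StrongDual ℝ (Lp ℝ 1 ν)) :
    ∃ b : Lp ℝ ∞ ν, ∀ l, φ l = pairing ν b l := by
  -- The inclusion of `L₂` in `L₁`, as Hölder multiplication by the constant 1.
  let J : Lp ℝ 2 ν →L[ℝ] Lp ℝ 1 ν :=
    (ContinuousLinearMap.mul ℝ ℝ).holderL ν 2 2 1 (Lp.const 2 ν 1)
  have hJ : ∀ v, J v =ᵐ[ν] v := fun v => by
    filter_upwards [(ContinuousLinearMap.mul ℝ ℝ).coeFn_holder (r := 1) (Lp.const 2 ν (1 : ℝ)) v,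
      Lp.coeFn_const 2 ν (1 : ℝ)] with x h1 h2
    refine h1.trans ?_
    rw [h2]
    simp
  let w : Lp ℝ 2 ν := (InnerProductSpace.toDual ℝ (Lp ℝ 2 ν)).symm (φ.comp J)
  have hset : ∀ s (hs : MeasurableSet s),
      ∫ x in s, w x ∂ν = φ (indicatorConstLp 1 hs (measure_ne_top ν s) 1) := by
    intro s hs
    rw [← L2.inner_indicatorConstLp_one (𝕜 := ℝ) hs (measure_ne_top ν s), real_inner_comm,
      InnerProductSpace.toDual_symm_apply]
    change φ (J _) = _
    congr 1
    refine Lp.ext ((hJ _).trans (indicatorConstLp_coeFn.trans indicatorConstLp_coeFn.symm))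
  have hw : Integrable w ν := (Lp.memLp w).integrable (by norm_num)
  have hnorm : ∀ s (hs : MeasurableSet s),
      |φ (indicatorConstLp 1 hs (measure_ne_top ν s) 1)| ≤ ∫ _ in s, ‖φ‖ ∂ν := by
    intro s hs
    refine (φ.le_opNorm _).trans ?_
    rw [norm_indicatorConstLp one_ne_zero ENNReal.one_ne_top]
    simp [mul_comm]
  have hle : ∀ᵐ x ∂ν, ‖w x‖ ≤ ‖φ‖ := by
    have h1 : w ≤ᵐ[ν] fun _ => ‖φ‖ := by
      refine ae_le_of_forall_setIntegral_le hw (integrable_const _) fun s hs _ => ?_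
      rw [hset s hs]
      exact (le_abs_self _).trans (hnorm s hs)
    have h2 : (fun x => -w x) ≤ᵐ[ν] fun _ => ‖φ‖ := by
      refine ae_le_of_forall_setIntegral_le hw.neg (integrable_const _) fun s hs _ => ?_
      rw [integral_neg, hset s hs]
      exact (neg_le_abs _).trans (hnorm s hs)
    filter_upwards [h1, h2] with x h1 h2
    exact abs_le'.2 ⟨h1, h2⟩
  have hb : MemLp w ∞ ν := memLp_top_of_bound (Lp.memLp w).1 ‖φ‖ hle
  refine ⟨hb.toLp w, fun l => ?_⟩
  induction l using Lp.induction ENNReal.one_ne_top with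
  | indicatorConst c hs hνs =>
    have h1 : indicatorConstLp 1 hs hνs.ne c = c • indicatorConstLp 1 hs hνs.ne (1 : ℝ) := by
      refine Lp.ext ?_
      filter_upwards [indicatorConstLp_coeFn (p := 1) (hs := hs) (hμs := hνs.ne) (c := c),
        indicatorConstLp_coeFn (p := 1) (hs := hs) (hμs := hνs.ne) (c := (1 : ℝ)),
        Lp.coeFn_smul c (indicatorConstLp 1 hs hνs.ne (1 : ℝ))] with x h1 h2 h3
      rw [h1, h3, Pi.smul_apply, h2]
      simp only [indicator]
      split_ifs <;> simp
    rw [Lp.simpleFunc.coe_indicatorConst, h1, map_smul, map_smul, ← setIntegral_eq_pairing hs,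
      ← hset _ hs]
    congr 1
    exact integral_congr_ae (ae_restrict_of_ae hb.coeFn_toLp.symm)
  | add hf hg _ h1 h2 => rw [map_add, map_add, h1, h2]
  | isClosed => exact isClosed_eq φ.continuous (pairing ν _).continuous

/-- A positive integrable weight `w` reduces to the finite measure `w ν`: multiplication by `w`
identifies `L₁(w ν)` with `L₁(ν)`, and the two measures have the same null sets, hence the same
`L∞`. -/
theorem exists_pairing_eq [SigmaFinite ν] (φ : StrongDual ℝ (Lp ℝ 1 ν)) :
    ∃ b : Lp ℝ ∞ ν, ∀ l, φ l = pairing ν b l := by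
  obtain ⟨w, hw0, hw, hwint⟩ := exists_pos_lintegral_lt_of_sigmaFinite ν one_ne_zero
  have hwE : Measurable fun x => (w x : ℝ≥0∞) := hw.coe_nnreal_ennreal
  have : IsFiniteMeasure (ν.withDensity fun x => (w x : ℝ≥0∞)) :=
    isFiniteMeasure_withDensity (hwint.trans_le le_top).ne
  have hac : ν ≪ ν.withDensity fun x => (w x : ℝ≥0∞) :=
    withDensity_absolutelyContinuous' hwE.aemeasurable
      (ae_of_all _ fun x => by exact_mod_cast (hw0 x).ne')
  obtain ⟨b, hb⟩ := exists_pairing_eq_of_isFiniteMeasure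
    (φ.comp (withDensitySMulLI ν (E := ℝ) hw).toContinuousLinearMap)
  have hbm : MemLp b ∞ ν := by
    refine memLp_top_of_bound ((Lp.memLp b).1.mono_ac hac) ‖b‖ ?_
    exact hac (ae_norm_le_norm_Lp_top b)
  refine ⟨hbm.toLp b, fun l => ?_⟩
  have hl : MemLp (fun x => (w x : ℝ)⁻¹ * l x) 1 (ν.withDensity fun x => (w x : ℝ≥0∞)) := by
    rw [memLp_one_iff_integrable, integrable_withDensity_iff_integrable_smul hw]
    refine (memLp_one_iff_integrable.1 (Lp.memLp l)).congr (ae_of_all _ fun x => ?_)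
    have : (w x : ℝ) ≠ 0 := by exact_mod_cast (hw0 x).ne'
    simp [NNReal.smul_def, this]
  have h1 : withDensitySMulLI ν (E := ℝ) hw (hl.toLp _) = l := by
    refine Lp.ext ?_
    rw [withDensitySMulLI_apply]
    filter_upwards [(memL1_smul_of_L1_withDensity hw (hl.toLp _)).coeFn_toLp,
      hac hl.coeFn_toLp] with x h1 h2
    have : (w x : ℝ) ≠ 0 := by exact_mod_cast (hw0 x).ne'
    rw [h1, h2]
    simp [NNReal.smul_def, this]
  have h2 := hb (hl.toLp _)
  rw [ContinuousLinearMap.comp_apply] at h2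
  erw [h1] at h2
  rw [h2, pairing_apply, pairing_apply, integral_withDensity_eq_integral_smul hw]
  refine integral_congr_ae ?_
  filter_upwards [hac hl.coeFn_toLp, hbm.coeFn_toLp] with x h1 h2
  have : (w x : ℝ) ≠ 0 := by exact_mod_cast (hw0 x).ne'
  rw [h1, h2, NNReal.smul_def, smul_eq_mul]
  field_simp

end Dual

/-! ### The isometric representations on `L₁` -/

theorem Lp_smul_nonneg {α : Type*} [MeasurableSpace α] {μ : Measure α} {c : ℝ} (hc : 0 ≤ c)
    {f : Lp ℝ 1 μ} (hf : 0 ≤ f) : 0 ≤ c • f := by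
  rw [← Lp.coeFn_nonneg] at hf ⊢
  filter_upwards [hf, Lp.coeFn_smul c f] with x h1 h2
  rw [h2]
  exact smul_nonneg hc h1

section Translate

variable {X : Type u} {G : Type v} [Group G] [TopologicalSpace G] [TopologicalSpace X]
  [MeasurableSpace X] [BorelSpace X] [MulAction G X]

theorem measurable_density (ν : Measure X) (g : G) : Measurable (density ν g) :=
  Measure.measurable_rnDeriv _ _

variable (ν : Measure X) [SigmaFinite ν] [h : IsMeasurableAction G ν]

theorem density_lt_top (g : G) : ∀ᵐ x ∂ν, density ν g x < ∞ := by
  have : SigmaFinite (ν.map (fun y => g⁻¹ • y)) := (actionEquiv ν g⁻¹).sigmaFinite_map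
  exact Measure.rnDeriv_lt_top _ _

theorem density_one : density ν (1 : G) =ᵐ[ν] fun _ => 1 := by
  have : (fun x => density ν (1 : G) x) = ν.rnDeriv ν := by
    unfold density
    simp
  rw [show density ν (1 : G) = ν.rnDeriv ν from this]
  exact Measure.rnDeriv_self ν

/-- The chain rule for Radon-Nikodym derivatives. This cocycle identity is what makes `translate`
and `predualRep` homomorphisms. -/
theorem density_mul (g k : G) :
    density ν (k * g) =ᵐ[ν] fun x => density ν g x * density ν k (g • x) := by
  have hm := measurable_smul_of_action ν g
  refine ae_eq_of_forall_setLIntegral_eq_of_sigmaFinite (measurable_density ν _)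
    ((measurable_density ν g).mul ((measurable_density ν k).comp hm)) fun s hs _ => ?_
  have hF : Measurable fun y : X => s.indicator (1 : X → ℝ≥0∞) ((k * g)⁻¹ • y) :=
    (measurable_one.indicator hs).comp (measurable_smul_of_action ν _)
  have hF' : Measurable fun y : X => s.indicator (1 : X → ℝ≥0∞) (g⁻¹ • y) :=
    (measurable_one.indicator hs).comp (measurable_smul_of_action ν _)
  have h1 := lintegral_density_mul ν (k * g) hF.aemeasurable
  have h2 := lintegral_density_mul ν k hF.aemeasurable
  have h3 := lintegral_density_mul ν g ((measurable_density ν k).mul hF').aemeasurable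
  simp only [inv_smul_smul, mul_inv_rev, mul_smul, Pi.mul_apply] at h1 h2 h3
  rw [← lintegral_indicator hs, ← lintegral_indicator hs]
  calc ∫⁻ x, s.indicator (density ν (k * g)) x ∂ν
      = ∫⁻ x, density ν (k * g) x * s.indicator 1 x ∂ν := by
        congr 1 with x; by_cases hx : x ∈ s <;> simp [hx]
    _ = ∫⁻ x, density ν g x * (density ν k (g • x) * s.indicator 1 x) ∂ν := by
        -- Both sides equal the integral of the indicator of `s` at `(k * g)⁻¹ • y`: one change of
        -- variables by `k * g`, or one by `g` followed by one by `k`.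
        rw [h1, h3, h2]
    _ = _ := by congr 1 with x; by_cases hx : x ∈ s <;> simp [hx]

variable {E : Type*} [NormedAddCommGroup E] [NormedSpace ℝ E]

/-- `x ↦ (d g_* ν / d ν)(x) k(g⁻¹ x)`, the density of `g_*(k ν)` if `k` is real valued. -/
def translateFun (g : G) (k : X → E) (x : X) : E := (density ν g⁻¹ x).toReal • k (g⁻¹ • x)

omit [SigmaFinite ν] in
theorem translateFun_congr (g : G) {k l : X → E} (hkl : k =ᵐ[ν] l) :
    translateFun ν g k =ᵐ[ν] translateFun ν g l := by
  filter_upwards [(quasi_of_action ν g⁻¹).ae hkl] with x hx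
  simp only [translateFun, hx]

theorem lintegral_enorm_translateFun (g : G) {k : X → E} (hk : AEStronglyMeasurable k ν) :
    ∫⁻ x, ‖translateFun ν g k x‖ₑ ∂ν = ∫⁻ x, ‖k x‖ₑ ∂ν := by
  rw [← lintegral_density_mul ν g⁻¹ hk.enorm]
  refine lintegral_congr_ae ?_
  filter_upwards [density_lt_top ν g⁻¹] with x hx
  rw [translateFun, enorm_smul, Real.enorm_of_nonneg ENNReal.toReal_nonneg,
    ENNReal.ofReal_toReal hx.ne]

theorem memLp_translateFun (g : G) {k : X → E} (hk : MemLp k 1 ν) :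
    MemLp (translateFun ν g k) 1 ν := by
  refine ⟨?_, ?_⟩
  · exact (measurable_density ν g⁻¹).ennreal_toReal.aestronglyMeasurable.smul
      (hk.1.comp_quasiMeasurePreserving (quasi_of_action ν g⁻¹))
  · rw [eLpNorm_one_eq_lintegral_enorm, lintegral_enorm_translateFun ν g hk.1,
      ← eLpNorm_one_eq_lintegral_enorm]
    exact hk.2

variable (G E) in
/-- The representation of `G` on `L₁(X, ν; E)` by push-forward of `E`-valued measures. -/
def translate : G →* (Lp E 1 ν →L[ℝ] Lp E 1 ν) where
  toFun g := LinearMap.mkContinuous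
    { toFun := fun k => (memLp_translateFun ν g (Lp.memLp k)).toLp _
      map_add' := fun k l => by
        rw [← MemLp.toLp_add]
        refine MemLp.toLp_congr _ _ ?_
        filter_upwards [translateFun_congr ν g (Lp.coeFn_add k l)] with x hx
        rw [hx]
        simp [translateFun]
      map_smul' := fun c k => by
        rw [RingHom.id_apply, ← MemLp.toLp_const_smul]
        refine MemLp.toLp_congr _ _ ?_
        filter_upwards [translateFun_congr ν g (Lp.coeFn_smul c k)] with x hx
        rw [hx]
        simp [translateFun, smul_comm c] }
    1
    (fun k => by
      rw [one_mul]
      change ‖(memLp_translateFun ν g (Lp.memLp k)).toLp _‖ ≤ _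
      rw [Lp.norm_toLp, Lp.norm_def, eLpNorm_one_eq_lintegral_enorm,
        lintegral_enorm_translateFun ν g (Lp.memLp k).1, eLpNorm_one_eq_lintegral_enorm])
  map_one' := by
    ext k
    refine (MemLp.coeFn_toLp (memLp_translateFun ν 1 (Lp.memLp k))).trans ?_
    filter_upwards [density_one (G := G) ν] with x hx
    simp [translateFun, hx]
  map_mul' g g' := by
    ext k
    refine (MemLp.coeFn_toLp (memLp_translateFun ν (g * g') (Lp.memLp k))).trans ?_
    refine EventuallyEq.trans ?_ (MemLp.coeFn_toLp (memLp_translateFun ν g (Lp.memLp _))).symm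
    refine EventuallyEq.trans ?_ (translateFun_congr ν g
      (MemLp.coeFn_toLp (memLp_translateFun ν g' (Lp.memLp k)))).symm
    filter_upwards [density_mul ν g⁻¹ g'⁻¹] with x hx
    simp [translateFun, hx, mul_smul]

theorem translate_coeFn (g : G) (k : Lp E 1 ν) :
    translate G ν E g k =ᵐ[ν] translateFun ν g k :=
  MemLp.coeFn_toLp (memLp_translateFun ν g (Lp.memLp k))

theorem norm_translate (g : G) (k : Lp E 1 ν) : ‖translate G ν E g k‖ = ‖k‖ := by
  have h1 := lintegral_congr_ae ((translate_coeFn ν g k).fun_comp enorm)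
  simp only [Function.comp_def] at h1
  rw [Lp.norm_def, eLpNorm_one_eq_lintegral_enorm, h1,
    lintegral_enorm_translateFun ν g (Lp.memLp k).1, Lp.norm_def, eLpNorm_one_eq_lintegral_enorm]

theorem norm_translate_le (g : G) (k : Lp E 1 ν) : ‖translate G ν E g k‖ ≤ ‖k‖ :=
  (norm_translate ν g k).le

/-- Change of variables. -/
theorem integral_translateFun_smul (g : G) (f : X → E) :
    ∫ x, (density ν g x).toReal • f (g • x) ∂ν = ∫ x, f x ∂ν := by
  have : SigmaFinite (ν.map (fun y => g⁻¹ • y)) := (actionEquiv ν g⁻¹).sigmaFinite_map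
  have h1 := integral_rnDeriv_smul (h.map_absolutelyContinuous g⁻¹) (f := fun x => f (g • x))
  refine h1.trans ?_
  have := (actionEquiv ν g⁻¹).measurableEmbedding.integral_map (μ := ν) (fun x => f (g • x))
  refine this.trans ?_
  congr 1 with x
  change f (g • g⁻¹ • x) = _
  rw [smul_inv_smul]

theorem integral_mul_translate (g : G) (b : X → ℝ) (l : Lp ℝ 1 ν) :
    ∫ x, b x * translate G ν ℝ g l x ∂ν = ∫ x, b (g • x) * l x ∂ν := by
  rw [← integral_translateFun_smul ν g⁻¹ fun x => b (g • x) * l x]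
  refine integral_congr_ae ?_
  filter_upwards [translate_coeFn ν g l] with x hx
  rw [hx]
  simp [translateFun]
  ring

end Translate

section Predual

variable {X : Type u} {G : Type v} [Group G] [TopologicalSpace G] [IsTopologicalGroup G]
  [MeasurableSpace G] [BorelSpace G] [TopologicalSpace X] [MeasurableSpace X] [BorelSpace X]
  [MulAction G X]

theorem leftTranslate_coeFn (η : Measure G) [η.IsHaarMeasure] (g : G) (f : Lp ℝ 1 η) :
    leftTranslate η g f =ᵐ[η] fun h => f (g⁻¹ * h) :=
  Lp.coeFn_compMeasurePreserving f _

theorem leftTranslate_one (η : Measure G) [η.IsHaarMeasure] (f : Lp ℝ 1 η) :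
    leftTranslate η 1 f = f :=
  Lp.ext ((leftTranslate_coeFn η 1 f).trans (by simp))

theorem leftTranslate_mul (η : Measure G) [η.IsHaarMeasure] (g k : G) (f : Lp ℝ 1 η) :
    leftTranslate η (g * k) f = leftTranslate η g (leftTranslate η k f) := by
  refine Lp.ext ((leftTranslate_coeFn η _ f).trans ?_)
  filter_upwards [leftTranslate_coeFn η g (leftTranslate η k f),
    (measurePreserving_mul_left η g⁻¹).quasiMeasurePreserving.ae (leftTranslate_coeFn η k f)]
    with x h1 h2
  rw [h1, h2]
  simp [mul_assoc]

theorem continuous_leftTranslate [LocallyCompactSpace G] [T2Space G] (η : Measure G)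
    [η.IsHaarMeasure] [η.Regular] (f : Lp ℝ 1 η) : Continuous fun g => leftTranslate η g f := by
  let F : G → C(G, G) := fun g => ⟨fun h => g⁻¹ * h, by fun_prop⟩
  have hF : Continuous F :=
    ContinuousMap.continuous_of_continuous_uncurry F
      (by simp only [Function.uncurry_def, F, ContinuousMap.coe_mk]; fun_prop)
  exact continuous_const.compMeasurePreservingLp hF
    (fun g => measurePreserving_mul_left η g⁻¹) ENNReal.one_ne_top

theorem leftTranslate_nonneg (η : Measure G) [η.IsHaarMeasure] (g : G) {f : Lp ℝ 1 η}
    (hf : 0 ≤ f) : 0 ≤ leftTranslate η g f := by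
  rw [← Lp.coeFn_nonneg] at hf ⊢
  filter_upwards [leftTranslate_coeFn η g f,
    (measurePreserving_mul_left η g⁻¹).quasiMeasurePreserving.ae hf] with x h1 h2
  rw [h1]
  exact h2

theorem integral_leftTranslate (η : Measure G) [η.IsHaarMeasure] (g : G) (f : Lp ℝ 1 η) :
    ∫ h, leftTranslate η g f h ∂η = ∫ h, f h ∂η := by
  rw [integral_congr_ae (leftTranslate_coeFn η g f)]
  exact integral_mul_left_eq_self f g⁻¹

variable (ν : Measure X) [SigmaFinite ν] [IsMeasurableAction G ν]
  (η : Measure G) [η.IsHaarMeasure]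

/-- The isometric representation of `G` on `L₁(X; L₁(G))`. -/
def predualRep : G →* (TensorPredual ν η →L[ℝ] TensorPredual ν η) where
  toFun g := predualTranslate ν η g⁻¹
  map_one' := by
    ext1 k
    refine Lp.ext ((predualTranslate_coeFn ν η _ k).trans ?_)
    filter_upwards [density_one (G := G) ν] with x hx
    simp [predualFun, hx, leftTranslate_one]
  map_mul' g g' := by
    ext1 k
    refine Lp.ext ((predualTranslate_coeFn ν η _ k).trans ?_)
    refine EventuallyEq.trans ?_ (predualTranslate_coeFn ν η _ _).symm
    filter_upwards [density_mul ν g⁻¹ g'⁻¹,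
      (quasi_of_action ν g⁻¹).ae (predualTranslate_coeFn ν η g'⁻¹ k)] with x h1 h2
    simp [predualFun, h1, h2, mul_smul, leftTranslate_mul]

theorem predualRep_apply (g : G) (k : TensorPredual ν η) :
    predualRep ν η g k = predualTranslate ν η g⁻¹ k := rfl

theorem predualRep_coeFn (g : G) (k : TensorPredual ν η) :
    predualRep ν η g k =ᵐ[ν]
      fun x => (density ν g⁻¹ x).toReal • leftTranslate η g (k (g⁻¹ • x)) := by
  refine (predualTranslate_coeFn ν η _ k).trans (ae_of_all _ fun x => ?_)
  simp [predualFun]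

theorem norm_predualRep_le (g : G) (k : TensorPredual ν η) : ‖predualRep ν η g k‖ ≤ ‖k‖ :=
  (LinearMap.mkContinuous_norm_le _ zero_le_one _ |> (predualTranslate ν η g⁻¹).le_of_opNorm_le)
    k |>.trans_eq (one_mul _)

end Predual

/-! ### Strong continuity -/

section Orbit

variable {G V : Type*} [Group G] [TopologicalSpace G] [IsTopologicalGroup G]
  [NormedAddCommGroup V] [NormedSpace ℝ V]

/-- Contractivity of `π g₀` bounds `‖π g v - π g₀ v‖` by `‖π (g₀⁻¹ * g) v - v‖`. -/
theorem continuous_orbit_of_tendsto_one (π : G →* (V →L[ℝ] V)) (hπ : ∀ g v, ‖π g v‖ ≤ ‖v‖) {v : V}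
    (h : Tendsto (fun g => π g v) (𝓝 1) (𝓝 v)) : Continuous fun g => π g v := by
  refine continuous_iff_continuousAt.2 fun g₀ => ?_
  rw [ContinuousAt, tendsto_iff_norm_sub_tendsto_zero]
  have h1 : Tendsto (fun g => g₀⁻¹ * g) (𝓝 g₀) (𝓝 1) := by
    have : Continuous fun g => g₀⁻¹ * g := by fun_prop
    simpa using this.tendsto g₀
  refine squeeze_zero (fun _ => norm_nonneg _) (fun g => ?_)
    ((tendsto_iff_norm_sub_tendsto_zero.1 h).comp h1)
  have : π g v - π g₀ v = π g₀ (π (g₀⁻¹ * g) v - v) := by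
    rw [map_sub, ← mul_apply_eq_comp, ← map_mul, mul_inv_cancel_left]
  rw [this]
  exact hπ _ _

/-- The vectors with norm continuous orbit form a closed subspace. -/
def continuousVectors (π : G →* (V →L[ℝ] V)) : Submodule ℝ V where
  carrier := {v | Continuous fun g => π g v}
  add_mem' {v w} hv hw := by
    simp only [mem_ofPred_eq, map_add] at *
    exact Continuous.add hv hw
  zero_mem' := by simpa using continuous_const
  smul_mem' c v hv := by
    simp only [mem_ofPred_eq, map_smul] at *
    exact Continuous.const_smul hv c

theorem isClosed_continuousVectors (π : G →* (V →L[ℝ] V)) (hπ : ∀ g v, ‖π g v‖ ≤ ‖v‖) :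
    IsClosed {v | Continuous fun g => π g v} := by
  refine isClosed_of_closure_subset fun v hv => ?_
  refine Metric.continuous_iff'.2 fun g₀ ε hε => ?_
  obtain ⟨w, hw, hvw⟩ := Metric.mem_closure_iff.1 hv (ε / 3) (by positivity)
  filter_upwards [Metric.continuous_iff'.1 hw g₀ (ε / 3) (by positivity)] with g hg
  have hd : ∀ g, dist (π g v) (π g w) < ε / 3 := fun g => by
    rw [dist_eq_norm, ← map_sub]
    exact (hπ g _).trans_lt (by rwa [← dist_eq_norm])
  calc dist (π g v) (π g₀ v)
      ≤ dist (π g v) (π g w) + dist (π g w) (π g₀ w) + dist (π g₀ w) (π g₀ v) :=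
        dist_triangle4 _ _ _ _
    _ < ε / 3 + ε / 3 + ε / 3 := by
        gcongr
        · exact hd g
        · rw [dist_comm]; exact hd g₀
    _ = ε := by ring

theorem eq_top_of_forall_dual_eq_zero {p : Submodule ℝ V} (hp : IsClosed (p : Set V))
    (h : ∀ φ : StrongDual ℝ V, (∀ v ∈ p, φ v = 0) → φ = 0) : p = ⊤ := by
  by_contra hne
  obtain ⟨x, hx⟩ : ∃ x, x ∉ p := by
    by_contra! hall
    exact hne ((Submodule.eq_top_iff'.2 hall))
  obtain ⟨φ, r, hφ, hr⟩ := geometric_hahn_banach_closed_point p.convex hp hx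
  -- A functional bounded above on a subspace vanishes there: otherwise some multiple of `v` attains
  -- the bound `r`.
  have h0 : ∀ v ∈ p, φ v = 0 := by
    intro v hv
    by_contra hne
    have := hφ ((r / φ v) • v) (p.smul_mem _ hv)
    rw [map_smul, smul_eq_mul, div_mul_cancel₀ _ hne] at this
    exact lt_irrefl _ this
  have h1 := hφ 0 p.zero_mem
  rw [h φ h0] at hr h1
  simp at hr h1
  linarith

end Orbit

/-- Cut `S` down to finite `ν`-measure with small loss for `m`, then choose a compact subset
exhausting it up to small `ν`-measure. Absolute continuity of the integral of `dm/dν` makes the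
`m`-measure of the remainder small. -/
theorem innerRegular_of_absolutelyContinuous {X : Type*} [TopologicalSpace X] [T2Space X]
    [MeasurableSpace X] [BorelSpace X] {m ν : Measure X} [SigmaFinite ν] [ν.InnerRegular]
    [IsFiniteMeasure m] (h : m ≪ ν) : m.InnerRegular := by
  refine ⟨fun S hS r hr => ?_⟩
  have hmono : Monotone fun n => S ∩ spanningSets ν n :=
    fun i j hij => inter_subset_inter_right _ (monotone_spanningSets ν hij)
  have hlim := tendsto_measure_iUnion_atTop (μ := m) hmono
  rw [← inter_iUnion, iUnion_spanningSets, inter_univ] at hlim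
  obtain ⟨n, hn⟩ := (hlim.eventually (lt_mem_nhds hr)).exists
  have hT : MeasurableSet (S ∩ spanningSets ν n) := hS.inter (measurableSet_spanningSets ν n)
  have hνT : ν (S ∩ spanningSets ν n) ≠ ∞ :=
    ((measure_mono inter_subset_right).trans_lt (measure_spanningSets_lt_top ν n)).ne
  have hint : ∫⁻ x, m.rnDeriv ν x ∂ν ≠ ∞ := (Measure.lintegral_rnDeriv_lt_top m ν).ne
  obtain ⟨δ, hδ, hδm⟩ := exists_pos_setLIntegral_lt_of_measure_lt hint (tsub_pos_of_lt hn).ne'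
  obtain ⟨K, hKT, hK, hνK⟩ := hT.exists_isCompact_sdiff_lt hνT hδ.ne'
  refine ⟨K, hKT.trans inter_subset_left, hK, ?_⟩
  have h1 := hδm _ hνK
  rw [Measure.setLIntegral_rnDeriv h] at h1
  have h2 : m (S ∩ spanningSets ν n) ≤ m K + m ((S ∩ spanningSets ν n) \ K) := by
    refine (measure_mono ?_).trans (measure_union_le _ _)
    rw [union_sdiff_cancel hKT]
  by_contra! hle
  refine absurd h2 (not_le.2 ?_)
  calc m K + m ((S ∩ spanningSets ν n) \ K)
      < r + (m (S ∩ spanningSets ν n) - r) :=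
        ENNReal.add_lt_add_of_le_of_lt (measure_ne_top _ _) hle h1
    _ = _ := add_tsub_cancel_of_le hn.le

/-- The sets where `w ≥ 0` and where `w < 0` each contribute at most `c`. -/
theorem norm_le_two_mul_of_setIntegral_le {X : Type*} [MeasurableSpace X] {ν : Measure X}
    (w : Lp ℝ 1 ν) {c : ℝ} (h : ∀ S, MeasurableSet S → |∫ x in S, w x ∂ν| ≤ c) :
    ‖w‖ ≤ 2 * c := by
  have hw : Integrable w ν := memLp_one_iff_integrable.1 (Lp.memLp w)
  have hS : MeasurableSet {x | 0 ≤ w x} :=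
    measurableSet_le measurable_const (Lp.stronglyMeasurable w).measurable
  have h1 : ‖w‖ = ∫ x, ‖w x‖ ∂ν := L1.norm_eq_integral_norm w
  rw [h1, ← integral_add_compl hS hw.norm]
  have h2 : ∫ x in {x | 0 ≤ w x}, ‖w x‖ ∂ν = ∫ x in {x | 0 ≤ w x}, w x ∂ν :=
    setIntegral_congr_fun hS fun x hx => abs_of_nonneg hx
  have h3 : ∫ x in {x | 0 ≤ w x}ᶜ, ‖w x‖ ∂ν = -∫ x in {x | 0 ≤ w x}ᶜ, w x ∂ν := by
    rw [← integral_neg]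
    exact setIntegral_congr_fun hS.compl fun x hx => abs_of_neg (not_le.1 hx)
  rw [h2, h3]
  have h4 := (le_abs_self _).trans (h _ hS)
  have h5 := (neg_le_abs _).trans (h _ hS.compl)
  linarith

-- Averages of a measure along the action, and continuity of their orbits

section Average

variable {X : Type u} {G : Type v} [Group G] [TopologicalSpace G] [IsTopologicalGroup G]
  [LocallyCompactSpace G] [T2Space G]
  [MeasurableSpace G] [BorelSpace G] [TopologicalSpace X] [T2Space X]
  [MeasurableSpace X] [BorelSpace X] [MulAction G X]

/-- The action as a map on the space `G × X`. -/
def actMap (p : BorelProd G X) : X := p.toProd.1 • p.toProd.2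

theorem measurable_actMap (ν : Measure X) [h : IsMeasurableAction G ν] :
    Measurable (actMap : BorelProd G X → X) := h.measurable_action

variable (ν : Measure X) [SigmaFinite ν] [ν.Regular] [h : IsMeasurableAction G ν]
  (η : Measure G) [η.IsHaarMeasure] [η.Regular]

/-- The average `∫_A h_* m dη(h)`. -/
def averageMeasure (m : Measure X) (η : Measure G) (A : Set G) : Measure X :=
  (borelProd m (η.restrict A)).map actMap

variable (m : Measure X) [IsFiniteMeasure m] [m.InnerRegular] (A : Set G)

include ν in
include ν in
theorem lintegral_averageMeasure {f : X → ℝ≥0∞} (hf : Measurable f) :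
    ∫⁻ x, f x ∂averageMeasure m η A = ∫⁻ g in A, ∫⁻ x, f (g • x) ∂m ∂η := by
  rw [averageMeasure, lintegral_map hf (measurable_actMap ν),
    lintegral_borelProd m _ (f := fun p => f (actMap p)) (hf.comp (measurable_actMap ν))]
  rfl

include ν in
theorem averageMeasure_apply {S : Set X} (hS : MeasurableSet S) :
    averageMeasure m η A S = ∫⁻ g in A, m ((fun x => g • x) ⁻¹' S) ∂η := by
  have := lintegral_averageMeasure ν η m A (measurable_one.indicator hS)
  rw [lintegral_indicator_one hS] at this
  rw [this]
  congr 1 with g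
  rw [← lintegral_indicator_one (measurable_smul_of_action ν g hS)]
  rfl

include ν in
theorem averageMeasure_ne_top (hA : η A ≠ ∞) (S : Set X) : averageMeasure m η A S ≠ ∞ := by
  refine ((measure_mono (subset_univ S)).trans_lt ?_).ne
  rw [averageMeasure_apply ν η m A MeasurableSet.univ]
  simpa using ENNReal.mul_lt_top (measure_lt_top m univ) hA.lt_top

theorem averageMeasure_absolutelyContinuous (hm : m ≪ ν) : averageMeasure m η A ≪ ν := by
  refine Measure.AbsolutelyContinuous.mk fun S hS hνS => ?_
  rw [averageMeasure_apply ν η m A hS]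
  have : ∀ g : G, m ((fun x => g • x) ⁻¹' S) = 0 := fun g =>
    hm ((quasi_of_action ν g).preimage_null hνS)
  simp [this]

-- By left invariance of `η`, pushing the average over `A` forward by `g` gives the average over
-- `gA`, which is the set `(fun h => g⁻¹ * h) ⁻¹' A`. Each `h_* m` has total mass `m univ`, so the
-- two averages differ by at most this mass times `η(gA ∆ A)`.
include ν in
theorem averageMeasure_preimage_le {g : G} (hA : MeasurableSet A) {S : Set X}
    (hS : MeasurableSet S) :
    averageMeasure m η A ((fun x => g • x) ⁻¹' S) ≤ averageMeasure m η A S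
        + m univ * η (symmDiff ((fun h => g⁻¹ * h) ⁻¹' A) A) ∧
      averageMeasure m η A S ≤ averageMeasure m η A ((fun x => g • x) ⁻¹' S)
        + m univ * η (symmDiff ((fun h => g⁻¹ * h) ⁻¹' A) A) := by
  set A' := (fun h => g⁻¹ * h) ⁻¹' A with hA'
  have hA'm : MeasurableSet A' := (measurable_const_mul g⁻¹) hA
  have h1 : averageMeasure m η A ((fun x => g • x) ⁻¹' S)
      = ∫⁻ k in A', m ((fun x => k • x) ⁻¹' S) ∂η := by
    rw [averageMeasure_apply ν η m A (measurable_smul_of_action ν g hS), ← lintegral_indicator hA,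
      ← lintegral_indicator hA'm, ← lintegral_mul_left_eq_self (A'.indicator _) g]
    congr 1 with k
    have : k ∈ A ↔ g * k ∈ A' := by simp [hA']
    by_cases hk : k ∈ A
    · rw [indicator_of_mem hk, indicator_of_mem (this.1 hk)]
      congr 1 with x
      simp [mul_smul]
    · rw [indicator_of_notMem hk, indicator_of_notMem (fun h => hk (this.2 h))]
  have key : ∀ B C : Set G, MeasurableSet B → MeasurableSet C →
      ∫⁻ k in B, m ((fun x => k • x) ⁻¹' S) ∂η
        ≤ ∫⁻ k in C, m ((fun x => k • x) ⁻¹' S) ∂η + m univ * η (symmDiff B C) := by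
    intro B C hB hC
    have hsub : B ⊆ C ∪ symmDiff B C := fun k hk => by
      by_cases hkC : k ∈ C
      · exact Or.inl hkC
      · exact Or.inr (Or.inl ⟨hk, hkC⟩)
    calc ∫⁻ k in B, m ((fun x => k • x) ⁻¹' S) ∂η
        ≤ ∫⁻ k in C ∪ symmDiff B C, m ((fun x => k • x) ⁻¹' S) ∂η := lintegral_mono_set hsub
      _ ≤ ∫⁻ k in C, m ((fun x => k • x) ⁻¹' S) ∂η
          + ∫⁻ k in symmDiff B C, m ((fun x => k • x) ⁻¹' S) ∂η := lintegral_union_le _ _ _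
      _ ≤ _ := by
        gcongr
        refine (lintegral_mono fun k => measure_mono (subset_univ _)).trans ?_
        simp
  rw [h1, averageMeasure_apply ν η m A hS]
  exact ⟨key _ _ hA'm hA, by rw [symmDiff_comm]; exact key _ _ hA hA'm⟩

/-- The density of `∫_A h_* m dη(h)` with respect to `ν`. -/
def averageDensity (hA : η A ≠ ∞) : Lp ℝ 1 ν :=
  haveI : IsFiniteMeasure (averageMeasure m η A) :=
    ⟨(averageMeasure_ne_top ν η m A hA univ).lt_top⟩
  (memLp_one_iff_integrable.2 (Measure.integrable_toReal_rnDeriv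
    (μ := averageMeasure m η A) (ν := ν))).toLp _

theorem integral_mul_averageDensity (hm : m ≪ ν) (hA : η A ≠ ∞) (b : X → ℝ) :
    ∫ x, b x * averageDensity ν η m A hA x ∂ν = ∫ x, b x ∂averageMeasure m η A := by
  have : IsFiniteMeasure (averageMeasure m η A) :=
    ⟨(averageMeasure_ne_top ν η m A hA univ).lt_top⟩
  rw [← integral_rnDeriv_smul (averageMeasure_absolutelyContinuous ν η m A hm)]
  refine integral_congr_ae ?_
  filter_upwards [(memLp_one_iff_integrable.2 (Measure.integrable_toReal_rnDeriv
    (μ := averageMeasure m η A) (ν := ν))).coeFn_toLp] with x hx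
  rw [averageDensity, hx, smul_eq_mul, mul_comm]

theorem norm_translate_averageDensity_sub_le (hm : m ≪ ν) (hAm : MeasurableSet A) (hA : η A ≠ ∞)
    (g : G) :
    ‖translate G ν ℝ g (averageDensity ν η m A hA) - averageDensity ν η m A hA‖
      ≤ 2 * (m univ * η (symmDiff ((fun h => g⁻¹ * h) ⁻¹' A) A)).toReal := by
  refine norm_le_two_mul_of_setIntegral_le _ fun S hS => ?_
  set k := averageDensity ν η m A hA
  have hint : ∀ l : Lp ℝ 1 ν, Integrable l ν := fun l => memLp_one_iff_integrable.1 (Lp.memLp l)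
  have h1 : ∀ (l : Lp ℝ 1 ν) (T : Set X), MeasurableSet T →
      ∫ x in T, l x ∂ν = ∫ x, T.indicator 1 x * l x ∂ν := by
    intro l T hT
    rw [← integral_indicator hT]
    congr 1 with x
    by_cases hx : x ∈ T <;> simp [hx]
  have h2 : ∫ x in S, (translate G ν ℝ g k - k) x ∂ν
      = (averageMeasure m η A ((fun x => g • x) ⁻¹' S)).toReal
        - (averageMeasure m η A S).toReal := by
    rw [integral_congr_ae (ae_restrict_of_ae (Lp.coeFn_sub _ _))]
    simp only [Pi.sub_apply]
    rw [integral_sub (hint _).integrableOn (hint _).integrableOn, h1 _ S hS, h1 _ S hS,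
      integral_mul_translate, integral_mul_averageDensity ν η m A hm hA,
      integral_mul_averageDensity ν η m A hm hA]
    rw [integral_indicator_one hS]
    have := integral_indicator_one (μ := averageMeasure m η A) (measurable_smul_of_action ν g hS)
    exact congrArg₂ _ this rfl
  rw [h2]
  obtain ⟨h3, h4⟩ := averageMeasure_preimage_le ν η m A (g := g) hAm hS
  have hft := averageMeasure_ne_top ν η m A hA
  have hsd : m univ * η (symmDiff ((fun h => g⁻¹ * h) ⁻¹' A) A) ≠ ∞ := by
    refine (ENNReal.mul_lt_top (measure_lt_top m univ) ?_).ne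
    refine (measure_mono symmDiff_subset_union).trans_lt ((measure_union_le _ _).trans_lt ?_)
    rw [measure_preimage_mul]
    exact ENNReal.add_lt_top.2 ⟨hA.lt_top, hA.lt_top⟩
  have h3' := ENNReal.toReal_mono (ENNReal.add_ne_top.2 ⟨hft _, hsd⟩) h3
  have h4' := ENNReal.toReal_mono (ENNReal.add_ne_top.2 ⟨hft _, hsd⟩) h4
  rw [ENNReal.toReal_add (hft _) hsd] at h3' h4'
  exact abs_sub_le_iff.2 ⟨by linarith, by linarith⟩

/-- Smoothing over `A` turns continuity in the action variable into continuity of `g ↦ η(gA ∆ A)` at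
1, which holds for a regular Haar measure whatever the action is. -/
theorem continuous_translate_averageDensity (hm : m ≪ ν) (hAm : MeasurableSet A) (hA : η A ≠ ∞) :
    Continuous fun g => translate G ν ℝ g (averageDensity ν η m A hA) := by
  refine continuous_orbit_of_tendsto_one (translate G ν ℝ) (norm_translate_le ν) ?_
  rw [tendsto_iff_norm_sub_tendsto_zero]
  refine squeeze_zero (fun _ => norm_nonneg _)
    (norm_translate_averageDensity_sub_le ν η m A hm hAm hA) ?_
  let F : G → C(G, G) := fun g => ⟨fun h => g⁻¹ * h, by fun_prop⟩
  have hF : Continuous F :=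
    ContinuousMap.continuous_of_continuous_uncurry F
      (by simp only [Function.uncurry_def, F, ContinuousMap.coe_mk]; fun_prop)
  have hFm : ∀ g, MeasurePreserving (F g) η η := fun g => measurePreserving_mul_left η g⁻¹
  have h1 := tendsto_measure_symmDiff_preimage_nhds_zero (hF.tendsto 1)
    (Eventually.of_forall hFm) (hFm 1) hAm.nullMeasurableSet hA
  have hF1 : (F 1 : G → G) ⁻¹' A = A := by ext x; simp [F]
  rw [hF1] at h1
  have h2 := ENNReal.Tendsto.const_mul h1 (Or.inr (measure_ne_top m univ))
  rw [mul_zero] at h2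
  have h3 := ((ENNReal.tendsto_toReal ENNReal.zero_ne_top).comp h2).const_mul (2 : ℝ)
  rw [ENNReal.toReal_zero, mul_zero] at h3
  exact h3

end Average

-- Strong continuity of the representations on `L₁(X)` and `L₁(X; L₁(G))`

section StrongContinuity

variable {X : Type u} {G : Type v} [Group G] [TopologicalSpace G] [IsTopologicalGroup G]
  [LocallyCompactSpace G] [T2Space G]
  [MeasurableSpace G] [BorelSpace G] [TopologicalSpace X] [T2Space X]
  [MeasurableSpace X] [BorelSpace X] [MulAction G X]
  (ν : Measure X) [SigmaFinite ν] [ν.Regular] [h : IsMeasurableAction G ν]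
  (η : Measure G) [η.IsHaarMeasure] [η.Regular]

/-- A bounded function with vanishing integrals against all averages `∫_A h_* m dη(h)` is
nonpositive almost everywhere. -/
theorem ae_nonpos_of_integral_averageMeasure_eq_zero {b : X → ℝ} (hb : Measurable b) {c : ℝ}
    (hbc : ∀ x, |b x| ≤ c)
    (hint : ∀ (m : Measure X) [IsFiniteMeasure m] [m.InnerRegular] (A : Set G), m ≪ ν →
      MeasurableSet A → η A ≠ ∞ → ∫ x, b x ∂averageMeasure m η A = 0) :
    ∀ᵐ x ∂ν, b x ≤ 0 := by
  obtain ⟨w, hw0, hw, hwint⟩ := exists_pos_lintegral_lt_of_sigmaFinite ν one_ne_zero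
  have hwE : Measurable fun x => (w x : ℝ≥0∞) := hw.coe_nnreal_ennreal
  set m : Measure X := ν.withDensity fun x => (w x : ℝ≥0∞) with hm_def
  have hmfin : IsFiniteMeasure m := isFiniteMeasure_withDensity (hwint.trans_le le_top).ne
  have hνm : ν ≪ m :=
    withDensity_absolutelyContinuous' hwE.aemeasurable
      (ae_of_all _ fun x => by exact_mod_cast (hw0 x).ne')
  have hmν : m ≪ ν := withDensity_absolutelyContinuous _ _
  have hmreg : m.InnerRegular := innerRegular_of_absolutelyContinuous hmν
  obtain ⟨C, hC, hC1⟩ := exists_compact_mem_nhds (1 : G)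
  have hηC : η C ≠ ∞ := hC.measure_lt_top.ne
  have hηC0 : η C ≠ 0 := (Measure.measure_pos_of_mem_nhds η hC1).ne'
  have hCm : MeasurableSet C := hC.measurableSet
  have hκ : IsFiniteMeasure (η.restrict C) := isFiniteMeasure_restrict.2 hηC
  have hκC : (η.restrict C) Cᶜ = 0 := by simp [Measure.restrict_apply hCm.compl]
  set f₁ : X → ℝ≥0∞ := fun x => ENNReal.ofReal (b x)
  set f₂ : X → ℝ≥0∞ := fun x => ENNReal.ofReal (-b x)
  have hf₁ : Measurable f₁ := hb.ennreal_ofReal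
  have hf₂ : Measurable f₂ := hb.neg.ennreal_ofReal
  have hact := measurable_actMap (G := G) ν
  have hbound₁ : ∀ x, f₁ x ≤ ENNReal.ofReal c := fun x =>
    ENNReal.ofReal_le_ofReal ((le_abs_self _).trans (hbc x))
  have hbound₂ : ∀ x, f₂ x ≤ ENNReal.ofReal c := fun x =>
    ENNReal.ofReal_le_ofReal ((neg_le_abs _).trans (hbc x))
  -- The vanishing integrals, taken for `m` restricted to `T` and the average over `S ∩ C`, say that
  -- the positive and negative parts of `b(gx)` have equal integrals over every box `S × T`. Hence
  -- they define the same measure on all Borel sets of the product.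
  have heq : (borelProd m (η.restrict C)).withDensity (fun p => f₁ (actMap p))
      = (borelProd m (η.restrict C)).withDensity (fun p => f₂ (actMap p)) := by
    refine withDensity_borelProd_eq m _ hC hκC (hf₁.comp hact) (hf₂.comp hact)
      (ENNReal.ofReal_ne_top (r := c)) (fun p => hbound₁ _) (fun p => hbound₂ _) ?_
    intro S T hS hT
    have hmT : m.restrict T ≪ ν := Measure.restrict_le_self.absolutelyContinuous.trans hmν
    have hmTreg : (m.restrict T).InnerRegular := innerRegular_of_absolutelyContinuous hmT
    have hSC : η (S ∩ C) ≠ ∞ := ((measure_mono inter_subset_right).trans_lt hηC.lt_top).ne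
    have h0 := hint (m.restrict T) (S ∩ C) hmT (hS.inter hCm) hSC
    have hfin : IsFiniteMeasure (averageMeasure (m.restrict T) η (S ∩ C)) :=
      ⟨(averageMeasure_ne_top ν η _ _ hSC univ).lt_top⟩
    have hbint : Integrable b (averageMeasure (m.restrict T) η (S ∩ C)) :=
      Integrable.of_bound hb.aestronglyMeasurable c (ae_of_all _ hbc)
    have hneg : ∫⁻ x, ENNReal.ofReal (-b x) ∂averageMeasure (m.restrict T) η (S ∩ C) ≠ ∞ :=
      hbint.neg.lintegral_lt_top.ne
    rw [integral_eq_lintegral_pos_part_sub_lintegral_neg_part hbint, sub_eq_zero,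
      ENNReal.toReal_eq_toReal_iff' hbint.lintegral_lt_top.ne hneg,
      lintegral_averageMeasure ν η _ _ hf₁, lintegral_averageMeasure ν η _ _ hf₂] at h0
    rw [Measure.restrict_restrict hS]
    exact h0
  -- On the set where the positive part is nonzero the negative part vanishes, so comparing both
  -- measures on this set kills the positive part.
  have hP : MeasurableSet {p : BorelProd G X | 0 < f₁ (actMap p)} :=
    measurableSet_lt measurable_const (hf₁.comp hact)
  have h1 : ∫⁻ p, f₁ (actMap p) ∂borelProd m (η.restrict C) = 0 := by
    have h2 := congrArg (fun ρ => ρ {p : BorelProd G X | 0 < f₁ (actMap p)}) heq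
    simp only [withDensity_apply _ hP] at h2
    have h3 : ∫⁻ p in {p : BorelProd G X | 0 < f₁ (actMap p)}, f₂ (actMap p)
        ∂borelProd m (η.restrict C) = 0 := by
      rw [setLIntegral_congr_fun (g := fun _ => 0) hP, lintegral_zero]
      intro p hp
      have : 0 < b (actMap p) := ENNReal.ofReal_pos.1 hp
      exact ENNReal.ofReal_eq_zero.2 (by linarith)
    rw [h3] at h2
    rw [← lintegral_add_compl _ hP, h2, zero_add,
      setLIntegral_congr_fun (g := fun _ => 0) hP.compl, lintegral_zero]
    intro p hp
    simpa using hp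
  rw [lintegral_borelProd m _ (f := fun p => f₁ (actMap p)) (hf₁.comp hact),
    lintegral_eq_zero_iff (measurable_lintegral_mk m (f := fun p => f₁ (actMap p))
      (hf₁.comp hact))] at h1
  have : (ae (η.restrict C)).NeBot := by
    rw [ae_neBot]
    exact fun h => hηC0 (Measure.restrict_eq_zero.1 h)
  -- Fubini leaves one `g` in `C` with `b(gx) ≤ 0` for almost all `x`; quasi-invariance removes the
  -- `g`.
  obtain ⟨g, hg⟩ := h1.exists
  rw [Pi.zero_apply, lintegral_eq_zero_iff
    (f := fun x => f₁ (actMap (BorelProd.mk g x)))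
    (hf₁.comp (hact.comp (BorelProd.measurable_mk_right g)))] at hg
  have hg' : ∀ᵐ x ∂ν, f₁ (g • x) = 0 := hνm hg
  filter_upwards [(quasi_of_action ν g⁻¹).ae hg'] with x hx
  rw [smul_inv_smul] at hx
  exact ENNReal.ofReal_eq_zero.1 hx

include η in
/-- The representation of `G` on `L₁(X, ν)` is strongly continuous. -/
theorem continuous_translate (l : Lp ℝ 1 ν) : Continuous fun g => translate G ν ℝ g l := by
  suffices continuousVectors (translate G ν ℝ) = ⊤ by
    have h1 : l ∈ continuousVectors (translate G ν ℝ) := this ▸ Submodule.mem_top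
    exact h1
  -- The vectors with continuous orbit form a closed subspace containing all `averageDensity`, so it
  -- remains to see that only the zero functional annihilates it.
  refine eq_top_of_forall_dual_eq_zero
    (isClosed_continuousVectors (translate G ν ℝ) (norm_translate_le ν)) fun φ hφ => ?_
  obtain ⟨b, hb⟩ := exists_pairing_eq φ
  -- A truncation of `b`, because the bound is needed at every point and not only almost everywhere.
  let b' : X → ℝ := fun x => max (-‖b‖) (min (b x) ‖b‖)
  have hb'm : Measurable b' :=
    measurable_const.max ((Lp.stronglyMeasurable b).measurable.min measurable_const)
  have hb' : ∀ x, |b' x| ≤ ‖b‖ := fun x =>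
    abs_le.2 ⟨le_max_left _ _, max_le (by linarith [norm_nonneg b]) (min_le_right _ _)⟩
  have hbb' : b =ᵐ[ν] b' := by
    filter_upwards [ae_norm_le_norm_Lp_top b] with x hx
    obtain ⟨h1, h2⟩ := abs_le.1 hx
    simp only [b', min_eq_left h2, max_eq_right h1]
  have hzero : ∀ (m : Measure X) [IsFiniteMeasure m] [m.InnerRegular] (A : Set G), m ≪ ν →
      MeasurableSet A → η A ≠ ∞ → ∫ x, b' x ∂averageMeasure m η A = 0 := by
    intro m _ _ A hm hAm hA
    rw [← integral_mul_averageDensity ν η m A hm hA,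
      ← hφ _ (continuous_translate_averageDensity ν η m A hm hAm hA), hb, pairing_apply]
    refine integral_congr_ae ?_
    filter_upwards [hbb'] with x hx
    rw [hx]
  have h1 := ae_nonpos_of_integral_averageMeasure_eq_zero ν η hb'm hb' hzero
  have h2 := ae_nonpos_of_integral_averageMeasure_eq_zero ν η (b := fun x => -b' x) hb'm.neg
    (c := ‖b‖) (fun x => by rw [abs_neg]; exact hb' x) fun m _ _ A hm hAm hA => by
      rw [integral_neg, hzero m A hm hAm hA, neg_zero]
  ext l
  rw [hb, pairing_apply, zero_apply, ← integral_zero X ℝ (μ := ν)]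
  refine integral_congr_ae ?_
  filter_upwards [hbb', h1, h2] with x h3 h4 h5
  rw [h3, show b' x = 0 by linarith, zero_mul]

/-- `l ⊗ f` in `L₁(X; L₁(G))`. -/
def tensor (l : Lp ℝ 1 ν) (f : Lp ℝ 1 η) : TensorPredual ν η :=
  (ContinuousLinearMap.toSpanSingleton ℝ f).compLp l

theorem tensor_coeFn (l : Lp ℝ 1 ν) (f : Lp ℝ 1 η) : tensor ν η l f =ᵐ[ν] fun x => l x • f := by
  filter_upwards [(ContinuousLinearMap.toSpanSingleton ℝ f).coeFn_compLp l] with x hx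
  rw [tensor, hx]
  simp

theorem norm_tensor_le (l : Lp ℝ 1 ν) (f : Lp ℝ 1 η) : ‖tensor ν η l f‖ ≤ ‖f‖ * ‖l‖ := by
  refine (ContinuousLinearMap.norm_compLp_le _ _).trans ?_
  rw [ContinuousLinearMap.norm_toSpanSingleton]

theorem predualRep_tensor (g : G) (l : Lp ℝ 1 ν) (f : Lp ℝ 1 η) :
    predualRep ν η g (tensor ν η l f)
      = tensor ν η (translate G ν ℝ g l) (leftTranslate η g f) := by
  refine Lp.ext ?_
  filter_upwards [predualRep_coeFn ν η g (tensor ν η l f),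
    (quasi_of_action ν g⁻¹).ae (tensor_coeFn ν η l f),
    tensor_coeFn ν η (translate G ν ℝ g l) (leftTranslate η g f), translate_coeFn ν g l]
    with x h1 h2 h3 h4
  rw [h1, h2, h3, h4, map_smul, translateFun, smul_smul, smul_eq_mul]

/-- The representation of `G` on `L₁(X; L₁(G))` is strongly continuous. -/
theorem continuous_predualRep (k : TensorPredual ν η) : Continuous fun g => predualRep ν η g k := by
  induction k using Lp.induction ENNReal.one_ne_top with
  | indicatorConst f hs hνs =>
    -- Indicators with a constant value in `L₁(G)` are elementary tensors, on which the
    -- representation acts diagonally.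
    have h1 : (Lp.simpleFunc.indicatorConst 1 hs hνs.ne f : TensorPredual ν η)
        = tensor ν η (indicatorConstLp 1 hs hνs.ne (1 : ℝ)) f := by
      rw [Lp.simpleFunc.coe_indicatorConst]
      refine Lp.ext ?_
      filter_upwards [indicatorConstLp_coeFn (p := 1) (hs := hs) (hμs := hνs.ne) (c := f),
        indicatorConstLp_coeFn (p := 1) (hs := hs) (hμs := hνs.ne) (c := (1 : ℝ)),
        tensor_coeFn ν η (indicatorConstLp 1 hs hνs.ne (1 : ℝ)) f] with x h1 h2 h3
      rw [h1, h3, h2]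
      simp only [indicator]
      split_ifs <;> simp
    rw [h1]
    set l : Lp ℝ 1 ν := indicatorConstLp 1 hs hνs.ne (1 : ℝ)
    refine continuous_orbit_of_tendsto_one (predualRep ν η) (norm_predualRep_le ν η) ?_
    simp_rw [predualRep_tensor]
    rw [tendsto_iff_norm_sub_tendsto_zero]
    have hl := tendsto_iff_norm_sub_tendsto_zero.1 ((continuous_translate ν η l).tendsto (1 : G))
    have hf := tendsto_iff_norm_sub_tendsto_zero.1 ((continuous_leftTranslate η f).tendsto 1)
    rw [map_one, one_apply_eq_self] at hl
    rw [leftTranslate_one] at hf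
    have h2 := (hl.const_mul ‖f‖).add (hf.mul_const ‖l‖)
    simp only [mul_zero, zero_mul, add_zero] at h2
    refine squeeze_zero (fun _ => norm_nonneg _) (fun g => ?_) h2
    have h3 : tensor ν η (translate G ν ℝ g l) (leftTranslate η g f) - tensor ν η l f
        = tensor ν η (translate G ν ℝ g l - l) (leftTranslate η g f)
          + tensor ν η l (leftTranslate η g f - f) := by
      refine Lp.ext ?_
      filter_upwards [tensor_coeFn ν η (translate G ν ℝ g l) (leftTranslate η g f),
        tensor_coeFn ν η l f, tensor_coeFn ν η (translate G ν ℝ g l - l) (leftTranslate η g f),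
        tensor_coeFn ν η l (leftTranslate η g f - f), Lp.coeFn_sub (translate G ν ℝ g l) l,
        Lp.coeFn_sub (tensor ν η (translate G ν ℝ g l) (leftTranslate η g f)) (tensor ν η l f),
        Lp.coeFn_add (tensor ν η (translate G ν ℝ g l - l) (leftTranslate η g f))
          (tensor ν η l (leftTranslate η g f - f))] with x h1 h2 h3 h4 h5 h6 h7
      rw [h6, h7, Pi.sub_apply, Pi.add_apply, h1, h2, h3, h4, h5, Pi.sub_apply, sub_smul, smul_sub]
      abel
    rw [h3]
    refine (norm_add_le _ _).trans (add_le_add ?_ (norm_tensor_le ν η _ _))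
    exact (norm_tensor_le ν η _ _).trans_eq (by rw [LinearIsometry.norm_map])
  | add hf hg _ h1 h2 =>
    simp only [map_add]
    exact h1.add h2
  | isClosed => exact isClosed_continuousVectors (predualRep ν η) (norm_predualRep_le ν η)

end StrongContinuity

/-! ### From pointwise to locally uniform asymptotic equivariance -/

/-- Continuity is local in `t`, so the compact set containing the supports may vary with `t`, as it
does for translates of a function in `C_c(G)`. -/
theorem continuous_integral_of_locally_compact_support {T Z E : Type*} [TopologicalSpace T]
    [TopologicalSpace Z] [MeasurableSpace Z] [OpensMeasurableSpace Z] {μ : Measure Z}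
    [IsFiniteMeasureOnCompacts μ] [NormedAddCommGroup E] [NormedSpace ℝ E] {f : T → Z → E}
    (hf : Continuous (Function.uncurry f))
    (hs : ∀ t, ∃ N ∈ 𝓝 t, ∃ k, IsCompact k ∧ ∀ p ∈ N, ∀ x, x ∉ k → f p x = 0) :
    Continuous fun t => ∫ x, f t x ∂μ := by
  refine continuous_iff_continuousAt.2 fun t => ?_
  obtain ⟨N, hN, k, hk, h⟩ := hs t
  exact (continuousOn_integral_of_compact_support hk hf.continuousOn
    fun p x hp hx => h p hp x hx).continuousAt hN

section Abstract

variable {G L Y ι : Type*} [Group G] [TopologicalSpace G] [IsTopologicalGroup G]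
  [LocallyCompactSpace G] [T2Space G] [MeasurableSpace G] [BorelSpace G]
  [NormedAddCommGroup L] [NormedSpace ℝ L] [NormedAddCommGroup Y] [NormedSpace ℝ Y]

theorem continuous_rep_apply {P : G →* (Y →L[ℝ] Y)} (hP : ∀ g y, ‖P g y‖ ≤ ‖y‖)
    (hPc : ∀ y, Continuous fun g => P g y) {T : Type*} [TopologicalSpace T] {g : T → G} {y : T → Y}
    (hg : Continuous g) (hy : Continuous y) : Continuous fun t => P (g t) (y t) := by
  refine continuous_iff_continuousAt.2 fun t₀ => ?_
  rw [ContinuousAt, tendsto_iff_norm_sub_tendsto_zero]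
  have h1 := tendsto_iff_norm_sub_tendsto_zero.1 (hy.tendsto t₀)
  have h2 := tendsto_iff_norm_sub_tendsto_zero.1 (((hPc (y t₀)).comp hg).tendsto t₀)
  have h3 := h1.add h2
  rw [add_zero] at h3
  refine squeeze_zero (fun _ => norm_nonneg _) (fun t => ?_) h3
  calc ‖P (g t) (y t) - P (g t₀) (y t₀)‖
      = ‖P (g t) (y t - y t₀) + (P (g t) (y t₀) - P (g t₀) (y t₀))‖ := by
        rw [map_sub, sub_add_sub_cancel]
    _ ≤ _ := (norm_add_le _ _).trans (add_le_add (hP _ _) le_rfl)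

variable (U : G →* (L →L[ℝ] L)) (P : G →* (Y →L[ℝ] Y))

/-- The conjugate `P(h) M U(h)⁻¹`. -/
def twist (M : L →L[ℝ] Y) (h : G) : L →L[ℝ] Y := (P h).comp (M.comp (U h⁻¹))

theorem twist_apply (M : L →L[ℝ] Y) (h : G) (l : L) : twist U P M h l = P h (M (U h⁻¹ l)) := rfl

theorem twist_one (M : L →L[ℝ] Y) : twist U P M 1 = M := by
  ext l; simp [twist_apply]

/-- With `k = 1` subtracted, this expresses the variation of the orbit at `s` through its variation
at 1, applied to `U s⁻¹ l`. -/
theorem twist_mul (M : L →L[ℝ] Y) (s k : G) (l : L) :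
    twist U P M (s * k) l = P s (twist U P M k (U s⁻¹ l)) := by
  simp [twist_apply]

variable {U P} (hU : ∀ g l, ‖U g l‖ ≤ ‖l‖) (hP : ∀ g y, ‖P g y‖ ≤ ‖y‖)
  (hUc : ∀ l, Continuous fun g => U g l) (hPc : ∀ y, Continuous fun g => P g y)

include hU hP

theorem norm_twist_le (M : L →L[ℝ] Y) (h : G) (l : L) : ‖twist U P M h l‖ ≤ ‖M‖ * ‖l‖ :=
  (hP _ _).trans ((M.le_opNorm _).trans (by gcongr; exact hU _ _))

include hUc hPc

theorem continuous_twist (M : L →L[ℝ] Y) (l : L) : Continuous fun h => twist U P M h l :=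
  continuous_rep_apply hP hPc continuous_id
    (M.continuous.comp ((hUc l).comp continuous_inv))

variable (η : Measure G) [IsFiniteMeasureOnCompacts η]

theorem integrable_smul_twist {f : G → ℝ} (hf : Continuous f) (hfs : HasCompactSupport f)
    (M : L →L[ℝ] Y) (l : L) : Integrable (fun h => f h • twist U P M h l) η :=
  (hf.smul (continuous_twist hU hP hUc hPc M l)).integrable_of_hasCompactSupport hfs.smul_right

theorem norm_integral_smul_twist_le {f : G → ℝ} (hf : Continuous f) (hfs : HasCompactSupport f)
    (M : L →L[ℝ] Y) (l : L) :
    ‖∫ h, f h • twist U P M h l ∂η‖ ≤ (∫ h, |f h| ∂η) * (‖M‖ * ‖l‖) := by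
  have hfi : Integrable (fun h => |f h|) η := (hf.integrable_of_hasCompactSupport hfs).abs
  rw [← integral_mul_const]
  refine norm_integral_le_of_norm_le (hfi.mul_const _) (ae_of_all _ fun h => ?_)
  rw [norm_smul, Real.norm_eq_abs]
  gcongr
  exact norm_twist_le hU hP M h l

/-- The average `∫ f(h) P(h) M U(h)⁻¹ dη(h)`. -/
def averageMap {f : G → ℝ} (hf : Continuous f) (hfs : HasCompactSupport f) (M : L →L[ℝ] Y) :
    L →L[ℝ] Y :=
  LinearMap.mkContinuous
    { toFun := fun l => ∫ h, f h • twist U P M h l ∂η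
      map_add' := fun l l' => by
        rw [← integral_add (integrable_smul_twist hU hP hUc hPc η hf hfs M l)
          (integrable_smul_twist hU hP hUc hPc η hf hfs M l')]
        simp
      map_smul' := fun c l => by
        rw [RingHom.id_apply, ← integral_smul]
        simp [smul_comm c] }
    ((∫ h, |f h| ∂η) * ‖M‖)
    (fun l => by
      rw [mul_assoc]
      exact norm_integral_smul_twist_le hU hP hUc hPc η hf hfs M l)

theorem averageMap_apply {f : G → ℝ} (hf : Continuous f) (hfs : HasCompactSupport f)
    (M : L →L[ℝ] Y) (l : L) :
    averageMap hU hP hUc hPc η hf hfs M l = ∫ h, f h • twist U P M h l ∂η := rfl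

omit hU hP hUc hPc
omit η [IsFiniteMeasureOnCompacts η] in
theorem continuous_integral_abs_sub_left (η : Measure G) [IsFiniteMeasureOnCompacts η]
    {f : G → ℝ} (hf : Continuous f) (hfs : HasCompactSupport f) (g₀ : G) :
    Continuous fun g => ∫ h, |f (g⁻¹ * h) - f (g₀⁻¹ * h)| ∂η := by
  refine continuous_integral_of_locally_compact_support
    (by simp only [Function.uncurry_def]; fun_prop) fun g => ?_
  obtain ⟨N, hN, hgN⟩ := exists_compact_mem_nhds g
  refine ⟨N, hgN, N * tsupport f ∪ {g₀} * tsupport f,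
    (hN.mul hfs).union (isCompact_singleton.mul hfs), fun p hp x hx => ?_⟩
  have h1 : f (p⁻¹ * x) = 0 := image_eq_zero_of_notMem_tsupport fun h =>
    hx (Or.inl (Set.mem_mul.2 ⟨p, hp, _, h, by simp⟩))
  have h2 : f (g₀⁻¹ * x) = 0 := image_eq_zero_of_notMem_tsupport fun h =>
    hx (Or.inr (Set.mem_mul.2 ⟨g₀, rfl, _, h, by simp⟩))
  rw [h1, h2, sub_zero, abs_zero]

omit η [IsFiniteMeasureOnCompacts η] in
theorem continuous_integral_abs_sub_right (η : Measure G) [IsFiniteMeasureOnCompacts η]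
    {f : G → ℝ} (hf : Continuous f) (hfs : HasCompactSupport f) (g₀ : G) :
    Continuous fun g => ∫ h, |f (h * g⁻¹) - f (h * g₀⁻¹)| ∂η := by
  refine continuous_integral_of_locally_compact_support
    (by simp only [Function.uncurry_def]; fun_prop) fun g => ?_
  obtain ⟨N, hN, hgN⟩ := exists_compact_mem_nhds g
  refine ⟨N, hgN, tsupport f * N ∪ tsupport f * {g₀},
    (hfs.isCompact.mul hN).union (hfs.isCompact.mul isCompact_singleton), fun p hp x hx => ?_⟩
  have h1 : f (x * p⁻¹) = 0 := image_eq_zero_of_notMem_tsupport fun h =>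
    hx (Or.inl (Set.mem_mul.2 ⟨_, h, p, hp, by simp⟩))
  have h2 : f (x * g₀⁻¹) = 0 := image_eq_zero_of_notMem_tsupport fun h =>
    hx (Or.inr (Set.mem_mul.2 ⟨_, h, g₀, rfl, by simp⟩))
  rw [h1, h2, sub_zero, abs_zero]

theorem hasCompactSupport_comp_mul_left {E : Type*} [Zero E] {f : G → E} (hfs : HasCompactSupport f)
    (g : G) : HasCompactSupport fun h => f (g * h) :=
  hfs.comp_homeomorph (Homeomorph.mulLeft g)

theorem hasCompactSupport_comp_mul_right {E : Type*} [Zero E] {f : G → E}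
    (hfs : HasCompactSupport f) (g : G) : HasCompactSupport fun h => f (h * g) :=
  hfs.comp_homeomorph (Homeomorph.mulRight g)

variable (F : Filter ι) (M : ι → L →L[ℝ] Y) (hM : ∀ i, ‖M i‖ ≤ 1)
  (hlim : ∀ h l, Tendsto (fun i => twist U P (M i) h l - M i l) F (𝓝 0))

include hU hP hUc hPc hM hlim

/-- Averages of `h ↦ P(h) Mᵢ U(h)⁻¹` against functions with integral zero tend to zero. -/
theorem eventually_norm_integral_smul_twist_le [CompleteSpace Y] (η : Measure G) [η.IsHaarMeasure]
    {φ : G → ℝ} (hφ : Continuous φ) (hφs : HasCompactSupport φ) (hφ0 : ∫ h, φ h ∂η = 0) (l : L)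
    {ε : ℝ} (hε : 0 < ε) : ∀ᶠ i in F, ‖∫ h, φ h • twist U P (M i) h l ∂η‖ ≤ ε := by
  have hM1 : ∀ i y, ‖M i y‖ ≤ ‖y‖ := fun i y =>
    ((M i).le_of_opNorm_le (hM i) y).trans_eq (one_mul _)
  have hW : ∀ i h y, ‖twist U P (M i) h y‖ ≤ ‖y‖ := fun i h y =>
    (hP _ _).trans ((hM1 i _).trans (hU _ _))
  -- A right invariant measure: the smoothing below integrates over `s` in `W (s * h)` and has to
  -- absorb right translation by `h`.
  set ρ := η.inv
  set I := ∫ h, |φ h| ∂η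
  have hI : 0 ≤ I := integral_nonneg fun h => abs_nonneg _
  -- an approximate unit
  obtain ⟨e, he, hes, he0, he1, heV⟩ : ∃ e : G → ℝ, Continuous e ∧ HasCompactSupport e ∧
      (∀ s, 0 ≤ e s) ∧ ∫ s, e s ∂ρ = 1 ∧
      ∀ s, e s ≠ 0 → (∫ h, |φ (s⁻¹ * h) - φ h| ∂η) * ‖l‖ < ε / 2 := by
    have h1 := (continuous_integral_abs_sub_left η hφ hφs 1).mul_const ‖l‖
    simp only [inv_one, one_mul] at h1
    have hV : IsOpen {s : G | (∫ h, |φ (s⁻¹ * h) - φ h| ∂η) * ‖l‖ < ε / 2} :=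
      isOpen_lt h1 continuous_const
    obtain ⟨e, he1, hes, heV, he01⟩ := exists_continuousMap_one_of_isCompact_subset_isOpen
      (isCompact_singleton (x := (1 : G))) hV (by simp [hε])
    have hpos : 0 < ∫ s, e s ∂ρ :=
      e.continuous.integral_pos_of_hasCompactSupport_nonneg_nonzero hes
        (fun s => (he01 s).1) (x := 1) (by rw [he1 rfl]; simp)
    refine ⟨fun s => (∫ s, e s ∂ρ)⁻¹ * e s, by fun_prop, HasCompactSupport.mul_left hes,
      fun s => mul_nonneg (inv_nonneg.2 hpos.le) (he01 s).1, ?_, fun s hs => ?_⟩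
    · rw [integral_const_mul, inv_mul_cancel₀ hpos.ne']
    · exact heV (subset_tsupport _ (right_ne_zero_of_mul hs))
  -- Chosen so that `I * ε' ≤ ε / 2`; the added 1 covers `I = 0`. Of the four quarters of `ε'`, one
  -- pays for moving `h` to a net point `k` and three for comparing `v k` with `v 1`.
  set ε' := ε / (2 * (I + 1)) with hε'_def
  have hε' : 0 < ε' := by positivity
  -- finite nets
  obtain ⟨S, hS⟩ : ∃ S : Finset G, ∀ h ∈ tsupport φ, ∃ k ∈ S,
      (∫ s, |e (s * h⁻¹) - e (s * k⁻¹)| ∂ρ) * ‖l‖ < ε' / 4 := by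
    obtain ⟨S, hS⟩ := hφs.isCompact.elim_finite_subcover
      (fun k : G => {h : G | (∫ s, |e (s * h⁻¹) - e (s * k⁻¹)| ∂ρ) * ‖l‖ < ε' / 4})
      (fun k => isOpen_lt ((continuous_integral_abs_sub_right ρ he hes k).mul_const _)
        continuous_const)
      (fun h _ => mem_iUnion.2 ⟨h, by simp [hε']⟩)
    exact ⟨S, fun h hh => by simpa using hS hh⟩
  obtain ⟨R, hR⟩ : ∃ R : Finset G, ∀ s ∈ tsupport e, ∃ r ∈ R,
      ‖U s⁻¹ l - U r⁻¹ l‖ < ε' / 4 := by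
    obtain ⟨R, hR⟩ := hes.isCompact.elim_finite_subcover
      (fun r : G => {s : G | ‖U s⁻¹ l - U r⁻¹ l‖ < ε' / 4})
      (fun r => isOpen_lt ((((hUc l).comp continuous_inv).sub continuous_const).norm)
        continuous_const)
      (fun h _ => mem_iUnion.2 ⟨h, by simp [hε']⟩)
    exact ⟨R, fun h hh => by simpa using hR hh⟩
  have hev : ∀ᶠ i in F, ∀ k ∈ S, ∀ r ∈ R,
      ‖twist U P (M i) k (U r⁻¹ l) - M i (U r⁻¹ l)‖ < ε' / 4 := by
    rw [Filter.eventually_all_finset]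
    intro k _
    rw [Filter.eventually_all_finset]
    intro r _
    have := (tendsto_zero_iff_norm_tendsto_zero.1 (hlim k (U r⁻¹ l))).eventually
      (gt_mem_nhds (show 0 < ε' / 4 by positivity))
    exact this
  filter_upwards [hev] with i hi
  set W : G → Y := fun h => twist U P (M i) h l with hW_def
  have hWc : Continuous W := continuous_twist hU hP hUc hPc (M i) l
  have hWb : ∀ h, ‖W h‖ ≤ ‖l‖ := fun h => hW i h l
  -- The maps `W` depend on `i` and need not be equicontinuous in `i`. Smoothing by `e` gives
  -- functions whose modulus of continuity depends only on `e` and `‖l‖`, so a finite net of points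
  -- chosen before `i` suffices.
  set v : G → Y := fun h => ∫ s, e s • W (s * h) ∂ρ with hv_def
  have hei : ∀ h, Integrable (fun s => e s • W (s * h)) ρ := fun h =>
    Continuous.integrable_of_hasCompactSupport (by fun_prop) hes.smul_right
  have hei1 : Integrable e ρ := he.integrable_of_hasCompactSupport hes
  -- `v` is almost constant on the support of `φ`
  have hv1 : ∀ k ∈ S, ‖v k - v 1‖ ≤ 3 * (ε' / 4) := by
    intro k hk
    have h1 : v k - v 1 = ∫ s, e s • (W (s * k) - W s) ∂ρ := by
      rw [hv_def]
      simp only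
      rw [← integral_sub (hei k) (hei 1)]
      simp [smul_sub]
    -- Uniform in `s`, since `U s⁻¹ l` runs through a compact set as `s` runs through the support of
    -- `e`, and it was covered by finitely many balls.
    have h2 : ∀ s, e s ≠ 0 → ‖W (s * k) - W s‖ ≤ 3 * (ε' / 4) := by
      intro s hs
      obtain ⟨r, hr, hsr⟩ := hR s (subset_tsupport _ hs)
      have h3 : W (s * k) - W s
          = P s (twist U P (M i) k (U s⁻¹ l) - M i (U s⁻¹ l)) := by
        have := twist_mul U P (M i) s 1 l
        rw [mul_one, twist_one] at this
        simp only [hW_def]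
        rw [twist_mul, this, map_sub]
      rw [h3]
      refine (hP _ _).trans ?_
      have h4 : twist U P (M i) k (U s⁻¹ l) - M i (U s⁻¹ l)
          = twist U P (M i) k (U s⁻¹ l - U r⁻¹ l)
            + (twist U P (M i) k (U r⁻¹ l) - M i (U r⁻¹ l))
            - M i (U s⁻¹ l - U r⁻¹ l) := by
        simp only [map_sub]; abel
      rw [h4]
      have h5 := (hW i k (U s⁻¹ l - U r⁻¹ l)).trans hsr.le
      have h6 := (hM1 i (U s⁻¹ l - U r⁻¹ l)).trans hsr.le
      have h7 := (hi k hk r hr).le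
      refine (norm_sub_le _ _).trans ?_
      refine (add_le_add (norm_add_le _ _) le_rfl).trans ?_
      linarith
    rw [h1]
    have h8 : ∫ s, e s * (3 * (ε' / 4)) ∂ρ = 3 * (ε' / 4) := by
      rw [integral_mul_const, he1, one_mul]
    rw [← h8]
    refine norm_integral_le_of_norm_le (hei1.mul_const _) (ae_of_all _ fun s => ?_)
    rw [norm_smul, Real.norm_of_nonneg (he0 s)]
    by_cases hs : e s = 0
    · simp [hs]
    · exact mul_le_mul_of_nonneg_left (h2 s hs) (he0 s)
  have hvr : ∀ h, v h = ∫ s, e (s * h⁻¹) • W s ∂ρ := fun h => by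
    rw [← integral_mul_right_eq_self _ h]
    simp [hv_def]
  have hv2 : ∀ h ∈ tsupport φ, ‖v h - v 1‖ ≤ ε' := by
    intro h hh
    obtain ⟨k, hk, hhk⟩ := hS h hh
    have hint : ∀ h, Integrable (fun s => e (s * h⁻¹) • W s) ρ := fun h =>
      Continuous.integrable_of_hasCompactSupport (by fun_prop)
        (hasCompactSupport_comp_mul_right hes h⁻¹).smul_right
    have hint' : ∀ h, Integrable (fun s => e (s * h⁻¹)) ρ := fun h =>
      Continuous.integrable_of_hasCompactSupport (by fun_prop)
        (hasCompactSupport_comp_mul_right hes h⁻¹)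
    have h1 : ‖v h - v k‖ ≤ (∫ s, |e (s * h⁻¹) - e (s * k⁻¹)| ∂ρ) * ‖l‖ := by
      rw [hvr, hvr, ← integral_sub (hint h) (hint k), ← integral_mul_const]
      refine norm_integral_le_of_norm_le (((hint' h).sub (hint' k)).abs.mul_const _)
        (ae_of_all _ fun s => ?_)
      rw [← sub_smul, norm_smul, Real.norm_eq_abs]
      exact mul_le_mul_of_nonneg_left (hWb s) (abs_nonneg _)
    have h2 := hv1 k hk
    calc ‖v h - v 1‖ = ‖(v h - v k) + (v k - v 1)‖ := by rw [sub_add_sub_cancel]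
      _ ≤ _ := norm_add_le _ _
      _ ≤ ε' / 4 + 3 * (ε' / 4) := by linarith
      _ = ε' := by ring
  -- the two iterated integrals
  have hφi : Integrable (fun h => φ h • W h) η :=
    Continuous.integrable_of_hasCompactSupport (by fun_prop) hφs.smul_right
  set A := ∫ h, φ h • W h ∂η with hA
  have hinner : ∀ s, ∫ h, φ h • W (s * h) ∂η = ∫ h, φ (s⁻¹ * h) • W h ∂η := fun s => by
    rw [← integral_mul_left_eq_self (fun h => φ (s⁻¹ * h) • W h) s]
    simp
  have hinnerc : Continuous fun s => ∫ h, φ h • W (s * h) ∂η :=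
    continuous_integral_of_locally_compact_support
      (by simp only [Function.uncurry_def]; fun_prop) fun s =>
        ⟨univ, univ_mem, tsupport φ, hφs, fun p _ x hx => by
          rw [image_eq_zero_of_notMem_tsupport hx, zero_smul]⟩
  have hB1 : ‖A - ∫ s, e s • ∫ h, φ h • W (s * h) ∂η ∂ρ‖ ≤ ε / 2 := by
    have h1 : A = ∫ s, e s • A ∂ρ := by rw [integral_smul_const, he1, one_smul]
    have h2 : Integrable (fun s => e s • A) ρ := hei1.smul_const A
    have h3 : Integrable (fun s => e s • ∫ h, φ h • W (s * h) ∂η) ρ :=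
      Continuous.integrable_of_hasCompactSupport (he.smul hinnerc) hes.smul_right
    have h4 : ∫ s, e s * (ε / 2) ∂ρ = ε / 2 := by rw [integral_mul_const, he1, one_mul]
    rw [h1, ← integral_sub h2 h3, ← h4]
    refine norm_integral_le_of_norm_le (hei1.mul_const _) (ae_of_all _ fun s => ?_)
    rw [← smul_sub, norm_smul, Real.norm_of_nonneg (he0 s)]
    by_cases hs : e s = 0
    · simp [hs]
    refine mul_le_mul_of_nonneg_left (le_trans ?_ (heV s hs).le) (he0 s)
    have hφt : Integrable (fun h => φ (s⁻¹ * h)) η :=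
      Continuous.integrable_of_hasCompactSupport (by fun_prop)
        (hasCompactSupport_comp_mul_left hφs s⁻¹)
    have h5 : Integrable (fun h => φ (s⁻¹ * h) • W h) η :=
      Continuous.integrable_of_hasCompactSupport (by fun_prop)
        (hasCompactSupport_comp_mul_left hφs s⁻¹).smul_right
    rw [hinner, hA, norm_sub_rev, ← integral_sub h5 hφi, ← integral_mul_const]
    refine norm_integral_le_of_norm_le
      ((hφt.sub (hφ.integrable_of_hasCompactSupport hφs)).abs.mul_const _) (ae_of_all _ fun h => ?_)
    rw [← sub_smul, norm_smul, Real.norm_eq_abs]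
    exact mul_le_mul_of_nonneg_left (hWb h) (abs_nonneg _)
  have hB2 : ∫ s, e s • ∫ h, φ h • W (s * h) ∂η ∂ρ = ∫ h, φ h • v h ∂η := by
    have h1 := integral_integral_swap_of_hasCompactSupport (μ := ρ) (ν := η)
      (f := fun s h => (e s * φ h) • W (s * h))
      (by simp only [Function.uncurry_def]; fun_prop)
      (HasCompactSupport.intro (hes.isCompact.prod hφs.isCompact) fun p hp => by
        simp only [Function.uncurry_def]
        rw [mem_prod, not_and_or] at hp
        rcases hp with hp | hp <;> simp [image_eq_zero_of_notMem_tsupport hp])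
    simp only [mul_smul, integral_smul] at h1
    rw [h1]
    congr 1 with h
    rw [hv_def, ← integral_smul]
    congr 1 with s
    rw [smul_comm]
  have hvc : Continuous v :=
    continuous_integral_of_locally_compact_support
      (by simp only [Function.uncurry_def]; fun_prop) fun h =>
        ⟨univ, univ_mem, tsupport e, hes, fun p _ x hx => by
          rw [image_eq_zero_of_notMem_tsupport hx, zero_smul]⟩
  have hB3 : ‖∫ h, φ h • v h ∂η‖ ≤ ε / 2 := by
    -- Here `∫ φ = 0` enters: subtracting the constant `v 1` changes nothing.
    have h1 : ∫ h, φ h • v h ∂η = ∫ h, φ h • (v h - v 1) ∂η := by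
      simp only [smul_sub]
      rw [integral_sub, integral_smul_const, hφ0, zero_smul, sub_zero]
      · exact Continuous.integrable_of_hasCompactSupport (by fun_prop) hφs.smul_right
      · exact (hφ.integrable_of_hasCompactSupport hφs).smul_const _
    rw [h1]
    refine (norm_integral_le_of_norm_le
      ((hφ.integrable_of_hasCompactSupport hφs).abs.mul_const ε') (ae_of_all _ fun h => ?_)).trans ?_
    · rw [norm_smul, Real.norm_eq_abs]
      by_cases hh : φ h = 0
      · simp [hh]
      · exact mul_le_mul_of_nonneg_left (hv2 h (subset_tsupport _ hh)) (abs_nonneg _)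
    · rw [integral_mul_const]
      calc I * ε' ≤ (I + 1) * ε' := by gcongr; linarith
        _ = ε / 2 := by rw [hε'_def]; field_simp
  rw [hB2] at hB1
  calc ‖A‖ = ‖(A - ∫ h, φ h • v h ∂η) + ∫ h, φ h • v h ∂η‖ := by rw [sub_add_cancel]
    _ ≤ _ := norm_add_le _ _
    _ ≤ ε / 2 + ε / 2 := add_le_add hB1 hB3
    _ = ε := by ring

/-- The averages of an asymptotically equivariant net of contractions are asymptotically
equivariant, uniformly on compact sets. -/
theorem eventually_forall_norm_averageMap_sub_le [CompleteSpace Y] (η : Measure G)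
    [η.IsHaarMeasure]
    {f : G → ℝ} (hf : Continuous f) (hfs : HasCompactSupport f) (hf0 : ∀ h, 0 ≤ f h)
    (hf1 : ∫ h, f h ∂η = 1) {K : Set G} (hK : IsCompact K) (l : L)
    {ε : ℝ} (hε : 0 < ε) :
    ∀ᶠ i in F, ∀ g ∈ K, ‖P g (averageMap hU hP hUc hPc η hf hfs (M i) l)
      - averageMap hU hP hUc hPc η hf hfs (M i) (U g l)‖ ≤ ε := by
  have hM1 : ∀ i y, ‖M i y‖ ≤ ‖y‖ := fun i y =>
    ((M i).le_of_opNorm_le (hM i) y).trans_eq (one_mul _)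
  have hW : ∀ i h y, ‖twist U P (M i) h y‖ ≤ ‖y‖ := fun i h y =>
    (hP _ _).trans ((hM1 i _).trans (hU _ _))
  obtain ⟨S, hS⟩ : ∃ S : Finset G, ∀ g ∈ K, ∃ k ∈ S,
      (∫ h, |f (g⁻¹ * h) - f (k⁻¹ * h)| ∂η) * ‖l‖ < ε / 3 ∧ ‖U g l - U k l‖ < ε / 6 := by
    obtain ⟨S, hS⟩ := hK.elim_finite_subcover
      (fun k : G => {g : G | (∫ h, |f (g⁻¹ * h) - f (k⁻¹ * h)| ∂η) * ‖l‖ < ε / 3} ∩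
        {g : G | ‖U g l - U k l‖ < ε / 6})
      (fun k => (isOpen_lt ((continuous_integral_abs_sub_left η hf hfs k).mul_const _)
        continuous_const).inter (isOpen_lt (((hUc l).sub continuous_const).norm)
        continuous_const))
      (fun h _ => mem_iUnion.2 ⟨h, by simp [hε]⟩)
    refine ⟨S, fun h hh => ?_⟩
    obtain ⟨k, hk, h1, h2⟩ := mem_iUnion₂.1 (hS hh)
    exact ⟨k, hk, h1, h2⟩
  have hfi : Integrable f η := hf.integrable_of_hasCompactSupport hfs
  have hft : ∀ g : G, Continuous (fun h => f (g⁻¹ * h)) := fun g => by fun_prop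
  have hfts : ∀ g : G, HasCompactSupport (fun h => f (g⁻¹ * h)) := fun g =>
    hasCompactSupport_comp_mul_left hfs g⁻¹
  have hfti : ∀ g : G, Integrable (fun h => f (g⁻¹ * h)) η := fun g =>
    (hft g).integrable_of_hasCompactSupport (hfts g)
  have hev : ∀ᶠ i in F, ∀ k ∈ S,
      ‖∫ h, (f (k⁻¹ * h) - f h) • twist U P (M i) h (U k l) ∂η‖ ≤ ε / 3 := by
    rw [Filter.eventually_all_finset]
    intro k _
    refine eventually_norm_integral_smul_twist_le hU hP hUc hPc F M hM hlim η
      ((hft k).sub hf) ((hfts k).sub hfs) ?_ (U k l) (by positivity)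
    exact (integral_sub (hfti k) hfi).trans
      (by rw [integral_mul_left_eq_self f k⁻¹, sub_self])
  filter_upwards [hev] with i hi g hg
  obtain ⟨k, hk, hgk, hUgk⟩ := hS g hg
  have hint := fun (a : G) (l : L) =>
    integrable_smul_twist hU hP hUc hPc η (hft a) (hfts a) (M i) l
  have hint1 := fun (l : L) => integrable_smul_twist hU hP hUc hPc η hf hfs (M i) l
  have h1 : P g (averageMap hU hP hUc hPc η hf hfs (M i) l)
      = ∫ h, f (g⁻¹ * h) • twist U P (M i) h (U g l) ∂η := by
    rw [averageMap_apply, ← ContinuousLinearMap.integral_comp_comm _ (hint1 l),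
      ← integral_mul_left_eq_self (fun h => f (g⁻¹ * h) • twist U P (M i) h (U g l)) g]
    congr 1 with h
    rw [map_smul, twist_mul, inv_mul_cancel_left]
    congr 3
    rw [← mul_apply_eq_comp, ← map_mul, inv_mul_cancel, map_one, one_apply_eq_self]
  -- Translating the average moves `g` onto the weight `f`. The first two terms are small because
  -- `k` is close to `g`. In the last one the weight has integral zero and `k` and `U k l` belong to
  -- a finite list, so the preceding lemma applies to it.
  have h2 : P g (averageMap hU hP hUc hPc η hf hfs (M i) l)
        - averageMap hU hP hUc hPc η hf hfs (M i) (U g l)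
      = (∫ h, (f (g⁻¹ * h) - f (k⁻¹ * h)) • twist U P (M i) h (U g l) ∂η)
        + (∫ h, (f (k⁻¹ * h) - f h) • twist U P (M i) h (U g l - U k l) ∂η)
        + ∫ h, (f (k⁻¹ * h) - f h) • twist U P (M i) h (U k l) ∂η := by
    rw [h1, averageMap_apply]
    simp only [sub_smul, map_sub, smul_sub]
    have hint2 : ∀ l, Integrable (fun h => f (k⁻¹ * h) • twist U P (M i) h l
        - f h • twist U P (M i) h l) η := fun l => (hint k l).sub (hint1 l)
    rw [integral_sub (hint g _) (hint k _), integral_sub (hint2 _) (hint2 _), integral_sub (hint k (U g l)) (hint1 (U g l)),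
      integral_sub (hint k (U k l)) (hint1 (U k l))]
    abel
  have h3 : ‖∫ h, (f (g⁻¹ * h) - f (k⁻¹ * h)) • twist U P (M i) h (U g l) ∂η‖ ≤ ε / 3 := by
    refine le_trans ?_ hgk.le
    rw [← integral_mul_const]
    refine norm_integral_le_of_norm_le (((hfti g).sub (hfti k)).abs.mul_const _)
      (ae_of_all _ fun h => ?_)
    rw [norm_smul, Real.norm_eq_abs]
    exact mul_le_mul_of_nonneg_left ((hW i h _).trans (hU _ _)) (abs_nonneg _)
  have h4 : ‖∫ h, (f (k⁻¹ * h) - f h) • twist U P (M i) h (U g l - U k l) ∂η‖ ≤ ε / 3 := by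
    -- The weight has total mass at most 2, which is why the net for `U g l` was chosen with mesh `ε
    -- / 6`.
    have h5 : ∫ h, (f (k⁻¹ * h) + f h) * (ε / 6) ∂η = ε / 3 := by
      rw [integral_mul_const, integral_add (hfti k) hfi, integral_mul_left_eq_self f k⁻¹, hf1]
      ring
    rw [← h5]
    refine norm_integral_le_of_norm_le (((hfti k).add hfi).mul_const _) (ae_of_all _ fun h => ?_)
    rw [norm_smul, Real.norm_eq_abs]
    have h6 : |f (k⁻¹ * h) - f h| ≤ f (k⁻¹ * h) + f h :=
      abs_sub_le_iff.2 ⟨by linarith [hf0 h], by linarith [hf0 (k⁻¹ * h)]⟩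
    exact mul_le_mul h6 ((hW i h _).trans hUgk.le) (norm_nonneg _)
      (add_nonneg (hf0 _) (hf0 _))
  rw [h2]
  refine (norm_add₃_le).trans ?_
  linarith [hi k hk]

end Abstract

/-! ### Borel maps as contractions `L₁(X) → L₁(X; L₁(G))` -/

section BorelMap

variable {X : Type u} {G : Type v} [Group G] [TopologicalSpace G] [IsTopologicalGroup G]
  [MeasurableSpace G] [BorelSpace G] [TopologicalSpace X] [MeasurableSpace X] [BorelSpace X]
  [MulAction G X]

section TopSmul

variable {ν : Measure X} {E : Type*} [NormedAddCommGroup E] [NormedSpace ℝ E]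

variable (E) in
/-- Multiplication by a bounded function on `L₁(X; E)`. -/
def topSmul (a : Lp ℝ ∞ ν) : Lp E 1 ν →L[ℝ] Lp E 1 ν :=
  (ContinuousLinearMap.lsmul ℝ ℝ (E := E)).holderL ν ∞ 1 1 a

theorem topSmul_coeFn (a : Lp ℝ ∞ ν) (l : Lp E 1 ν) :
    topSmul E a l =ᵐ[ν] fun x => a x • l x :=
  (ContinuousLinearMap.lsmul ℝ ℝ (E := E)).coeFn_holder (r := 1) a l

theorem tensorMul_apply {η : Measure G} (a : Lp ℝ ∞ ν) (F : LinftyTensor ν η)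
    (k : TensorPredual ν η) : tensorMul a F k = F (topSmul _ a k) := rfl

theorem pairing_topSmul (a b : Lp ℝ ∞ ν) (l : Lp ℝ 1 ν) :
    pairing ν b (topSmul ℝ a l) = ∫ x, a x * b x * l x ∂ν := by
  rw [pairing_apply]
  refine integral_congr_ae ?_
  filter_upwards [topSmul_coeFn a l] with x hx
  rw [hx, smul_eq_mul]
  ring

end TopSmul

variable (ν : Measure X) (η : Measure G)

theorem norm_eq_integral_of_nonneg {α : Type*} [MeasurableSpace α] {μ : Measure α} {f : Lp ℝ 1 μ}
    (hf : 0 ≤ f) : ‖f‖ = ∫ h, f h ∂μ := by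
  rw [L1.norm_eq_integral_norm]
  refine integral_congr_ae ?_
  filter_upwards [(Lp.coeFn_nonneg f).2 hf] with h hh
  exact Real.norm_of_nonneg hh

theorem norm_of_mem_probDensity {f : Lp ℝ 1 η} (hf : f ∈ ProbDensity η) : ‖f‖ = 1 :=
  (norm_eq_integral_of_nonneg hf.1).trans hf.2

/-- Integration along the fibres `L₁(X; L₁(G)) → L₁(X)`. -/
def fiberIntegral : TensorPredual ν η →L[ℝ] Lp ℝ 1 ν :=
  (L1.integralCLM (α := G) (E := ℝ) (μ := η)).compLpL 1 ν

variable {ν η}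

theorem fiberIntegral_coeFn (k : TensorPredual ν η) :
    fiberIntegral ν η k =ᵐ[ν] fun x => ∫ h, k x h ∂η := by
  filter_upwards [(L1.integralCLM (α := G) (E := ℝ) (μ := η)).coeFn_compLpL k] with x hx
  refine hx.trans ?_
  rw [← L1.integral_eq, L1.integral_eq_integral]

theorem tensorOne_apply (k : TensorPredual ν η) :
    tensorOne ν η k = ∫ x, fiberIntegral ν η k x ∂ν := by
  change L1.integralCLM (L1.integralCLM k) = _
  rw [← L1.integral_eq k, L1.integral_eq_integral, ← ContinuousLinearMap.integral_comp_comm _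
    (memLp_one_iff_integrable.1 (Lp.memLp k))]
  exact integral_congr_ae
    ((L1.integralCLM (α := G) (E := ℝ) (μ := η)).coeFn_compLpL k).symm

variable {μ : X → Lp ℝ 1 η}

theorem memLp_smul_borelMap (hμ : IsBorelMap η μ) (l : Lp ℝ 1 ν) :
    MemLp (fun x => l x • μ x) 1 ν :=
  (Lp.memLp l).of_le ((Lp.memLp l).1.smul hμ.stronglyMeasurable.aestronglyMeasurable)
    (ae_of_all _ fun x => by rw [norm_smul, norm_of_mem_probDensity η (hμ.mem x), mul_one])

variable (ν) in
/-- The map `l ↦ l μ` from `L₁(X)` to `L₁(X; L₁(G))`. -/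
def borelMul (hμ : IsBorelMap η μ) : Lp ℝ 1 ν →L[ℝ] TensorPredual ν η :=
  LinearMap.mkContinuous
    { toFun := fun l => (memLp_smul_borelMap hμ l).toLp _
      map_add' := fun k l => by
        rw [← MemLp.toLp_add]
        refine MemLp.toLp_congr _ _ ?_
        filter_upwards [Lp.coeFn_add k l] with x hx
        rw [hx]
        simp [add_smul]
      map_smul' := fun c k => by
        rw [RingHom.id_apply, ← MemLp.toLp_const_smul]
        refine MemLp.toLp_congr _ _ ?_
        filter_upwards [Lp.coeFn_smul c k] with x hx
        rw [hx]
        simp [smul_smul] }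
    1
    (fun k => by
      rw [one_mul]
      refine Lp.norm_le_norm_of_ae_le ?_
      filter_upwards [(memLp_smul_borelMap hμ k).coeFn_toLp] with x hx
      change ‖(memLp_smul_borelMap hμ k).toLp _ x‖ ≤ _
      rw [hx, norm_smul, norm_of_mem_probDensity η (hμ.mem x), mul_one])

theorem borelMul_coeFn (hμ : IsBorelMap η μ) (l : Lp ℝ 1 ν) :
    borelMul ν hμ l =ᵐ[ν] fun x => l x • μ x := (memLp_smul_borelMap hμ l).coeFn_toLp

theorem norm_borelMul_le (hμ : IsBorelMap η μ) : ‖borelMul ν hμ‖ ≤ 1 :=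
  LinearMap.mkContinuous_norm_le _ zero_le_one _

theorem borelMul_nonneg (hμ : IsBorelMap η μ) {l : Lp ℝ 1 ν} (hl : 0 ≤ l) :
    0 ≤ borelMul ν hμ l := by
  rw [← Lp.coeFn_nonneg] at hl ⊢
  filter_upwards [borelMul_coeFn hμ l, hl] with x h1 h2
  rw [h1]
  exact Lp_smul_nonneg h2 (hμ.mem x).1

theorem fiberIntegral_borelMul (hμ : IsBorelMap η μ) (l : Lp ℝ 1 ν) :
    fiberIntegral ν η (borelMul ν hμ l) = l := by
  refine Lp.ext ?_
  filter_upwards [fiberIntegral_coeFn (borelMul ν hμ l), borelMul_coeFn hμ l] with x h1 h2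
  rw [h1, h2, integral_congr_ae (Lp.coeFn_smul _ _)]
  simp only [Pi.smul_apply, smul_eq_mul]
  rw [integral_const_mul, (hμ.mem x).2, mul_one]

theorem topSmul_borelMul (hμ : IsBorelMap η μ) (a : Lp ℝ ∞ ν) (l : Lp ℝ 1 ν) :
    topSmul _ a (borelMul ν hμ l) = borelMul ν hμ (topSmul ℝ a l) := by
  refine Lp.ext ?_
  filter_upwards [topSmul_coeFn a (borelMul ν hμ l), borelMul_coeFn hμ l,
    borelMul_coeFn hμ (topSmul ℝ a l), topSmul_coeFn a l] with x h1 h2 h3 h4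
  rw [h1, h2, h3, h4, smul_smul, smul_eq_mul]

-- The defect as an intertwining error

section Defect

variable [SigmaFinite ν] [IsMeasurableAction G ν] [η.IsHaarMeasure]

theorem aestronglyMeasurable_defect (ν : Measure X) [IsMeasurableAction G ν]
    (hμ : IsBorelMap η μ) (g : G) :
    AEStronglyMeasurable (fun x => leftTranslate η g (μ x) - μ (g • x)) ν :=
  (((leftTranslate η g).continuous.comp_stronglyMeasurable hμ.stronglyMeasurable).sub
    (hμ.stronglyMeasurable.comp_measurable
      (measurable_smul_of_action ν g))).aestronglyMeasurable

/-- The difference on the left is the translate by `g` of `x ↦ l(x) (g μ^x - μ^{gx})`, and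
translation preserves the `L₁` norm. -/
theorem enorm_predualRep_borelMul_sub (hμ : IsBorelMap η μ) (g : G) (l : Lp ℝ 1 ν) :
    ‖predualRep ν η g (borelMul ν hμ l) - borelMul ν hμ (translate G ν ℝ g l)‖ₑ
      = ∫⁻ x, ‖l x‖ₑ * ‖leftTranslate η g (μ x) - μ (g • x)‖ₑ ∂ν := by
  have h1 : AEStronglyMeasurable (fun x => l x • (leftTranslate η g (μ x) - μ (g • x))) ν :=
    (Lp.memLp l).1.smul (aestronglyMeasurable_defect ν hμ g)
  have h2 := lintegral_enorm_translateFun ν g h1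
  simp only [enorm_smul] at h2
  rw [← h2, Lp.enorm_def, eLpNorm_one_eq_lintegral_enorm]
  refine lintegral_congr_ae ?_
  filter_upwards [Lp.coeFn_sub (predualRep ν η g (borelMul ν hμ l))
      (borelMul ν hμ (translate G ν ℝ g l)), predualRep_coeFn ν η g (borelMul ν hμ l),
    borelMul_coeFn hμ (translate G ν ℝ g l), translate_coeFn ν g l,
    (quasi_of_action ν g⁻¹).ae (borelMul_coeFn hμ l)] with x h3 h4 h5 h6 h7
  rw [h3, Pi.sub_apply, h4, h5, h6, h7]
  congr 1
  simp [translateFun, smul_sub, smul_smul]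

/-- The density of a measure `m ≪ ν` in `L₁(X, ν)`. -/
def measureDensity (ν m : Measure X) [IsFiniteMeasure m] : Lp ℝ 1 ν :=
  (memLp_one_iff_integrable.2 (Measure.integrable_toReal_rnDeriv (μ := m) (ν := ν))).toLp _

theorem enorm_predualRep_borelMul_measureDensity (hμ : IsBorelMap η μ) (g : G) {m : Measure X}
    [IsFiniteMeasure m] (hm : m ≪ ν) :
    ‖predualRep ν η g (borelMul ν hμ (measureDensity ν m))
        - borelMul ν hμ (translate G ν ℝ g (measureDensity ν m))‖ₑ
      = ∫⁻ x, ‖leftTranslate η g (μ x) - μ (g • x)‖ₑ ∂m := by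
  rw [enorm_predualRep_borelMul_sub,
    ← lintegral_rnDeriv_mul hm (aestronglyMeasurable_defect ν hμ g).enorm]
  refine lintegral_congr_ae ?_
  filter_upwards [(memLp_one_iff_integrable.2 (Measure.integrable_toReal_rnDeriv
    (μ := m) (ν := ν))).coeFn_toLp, Measure.rnDeriv_lt_top m ν] with x hx hx'
  rw [measureDensity, hx, Real.enorm_of_nonneg ENNReal.toReal_nonneg,
    ENNReal.ofReal_toReal hx'.ne]

/-- The probability measure `‖l‖⁻¹ |l| ν`. -/
def normalizedMeasure (l : Lp ℝ 1 ν) : Measure X :=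
  ν.withDensity fun x => ‖l‖ₑ⁻¹ * ‖l x‖ₑ

theorem lintegral_normalizedMeasure (l : Lp ℝ 1 ν) {f : X → ℝ≥0∞} (hf : AEMeasurable f ν) :
    ∫⁻ x, f x ∂(normalizedMeasure l) = ‖l‖ₑ⁻¹ * ∫⁻ x, ‖l x‖ₑ * f x ∂ν := by
  have hlm : Measurable fun x => ‖l x‖ₑ := (Lp.stronglyMeasurable l).enorm
  rw [normalizedMeasure, lintegral_withDensity_eq_lintegral_mul₀ (hlm.const_mul _).aemeasurable hf,
    ← lintegral_const_mul'' (f := fun x => ‖l x‖ₑ * f x) _ (hlm.aemeasurable.mul hf)]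
  refine lintegral_congr fun x => ?_
  rw [Pi.mul_apply, mul_assoc]

theorem isProbabilityMeasure_normalizedMeasure {l : Lp ℝ 1 ν} (hl : l ≠ 0) :
    IsProbabilityMeasure (normalizedMeasure l) := by
  refine ⟨?_⟩
  rw [← lintegral_one, lintegral_normalizedMeasure l aemeasurable_const]
  simp only [mul_one]
  rw [← eLpNorm_one_eq_lintegral_enorm, ← Lp.enorm_def]
  exact ENNReal.inv_mul_cancel (by simpa using hl) enorm_ne_top

theorem enorm_predualRep_borelMul_sub_le (hμ : IsBorelMap η μ) (g : G) {l : Lp ℝ 1 ν}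
    (hl : l ≠ 0) :
    ‖predualRep ν η g (borelMul ν hμ l) - borelMul ν hμ (translate G ν ℝ g l)‖ₑ
      ≤ ‖l‖ₑ * defect η (normalizedMeasure l) {g} μ := by
  have h3 : ∫⁻ x, ‖leftTranslate η g (μ x) - μ (g • x)‖ₑ ∂(normalizedMeasure l)
      ≤ defect η (normalizedMeasure l) {g} μ := by
    simp [defect]
  refine le_trans ?_ (mul_le_mul_right h3 _)
  rw [lintegral_normalizedMeasure l (aestronglyMeasurable_defect ν hμ g).enorm, ← mul_assoc,
    ENNReal.mul_inv_cancel (by simpa using hl) enorm_ne_top, one_mul,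
    enorm_predualRep_borelMul_sub]

/-- An asymptotically equivariant net is asymptotically equivariant with respect to all densities
in `L₁(X, ν)`. -/
theorem AsymptoticallyEquivariant.tendsto {ι : Type*} [Preorder ι] [IsDirectedOrder ι] [Nonempty ι]
    {μ : ι → X → Lp ℝ 1 η} (hμ : ∀ i, IsBorelMap η (μ i))
    (h : AsymptoticallyEquivariant ν η μ) (g : G) (l : Lp ℝ 1 ν) :
    Tendsto (fun i => predualRep ν η g (borelMul ν (hμ i) l)
      - borelMul ν (hμ i) (translate G ν ℝ g l)) atTop (𝓝 0) := by
  by_cases hl : l = 0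
  · simp [hl]
  rw [tendsto_zero_iff_norm_tendsto_zero]
  refine Metric.tendsto_nhds.2 fun ε hε => ?_
  have hlpos : 0 < ‖l‖ := norm_pos_iff.2 hl
  obtain ⟨i₀, hi₀⟩ := h (normalizedMeasure l) (isProbabilityMeasure_normalizedMeasure hl)
    (withDensity_absolutelyContinuous _ _) (ε / ‖l‖) (by positivity) {g} isCompact_singleton
  filter_upwards [eventually_ge_atTop i₀] with i hi
  have h4 := (enorm_predualRep_borelMul_sub_le (hμ i) g hl).trans_lt
    ((ENNReal.mul_lt_mul_iff_right (by simpa using hl) enorm_ne_top).2 (hi₀ i hi))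
  rw [← ofReal_norm l, ← ENNReal.ofReal_mul (norm_nonneg _), mul_div_cancel₀ _ hlpos.ne',
    ← ofReal_norm, ENNReal.ofReal_lt_ofReal_iff hε] at h4
  simpa using h4

end Defect

/-- A limit point of a net of contractions `L₁(X) → Y`, as a map from the dual of `Y`
to `L∞(X)`. -/
theorem exists_ultrafilter_limit [SigmaFinite ν] {Y : Type*} [NormedAddCommGroup Y]
    [NormedSpace ℝ Y] {ι : Type*} (𝒰 : Ultrafilter ι) (M : ι → Lp ℝ 1 ν →L[ℝ] Y)
    (hM : ∀ i, ‖M i‖ ≤ 1) :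
    ∃ E : StrongDual ℝ Y →ₗ[ℝ] Lp ℝ ∞ ν, ∀ F l,
      Tendsto (fun i => F (M i l)) 𝒰 (𝓝 (pairing ν (E F) l)) := by
  have hbound : ∀ (F : StrongDual ℝ Y) l i, ‖F (M i l)‖ ≤ ‖F‖ * ‖l‖ := fun F l i =>
    F.le_opNorm_of_le (((M i).le_of_opNorm_le (hM i) l).trans_eq (one_mul _))
  have hlim : ∀ (F : StrongDual ℝ Y) l, ∃ c : ℝ, Tendsto (fun i => F (M i l)) 𝒰 (𝓝 c) := by
    intro F l
    -- Bounded real numbers converge along every ultrafilter.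
    obtain ⟨c, -, hc⟩ := (isCompact_closedBall (0 : ℝ) (‖F‖ * ‖l‖)).ultrafilter_le_nhds
      (𝒰.map fun i => F (M i l)) (by
        rw [le_principal_iff]
        exact mem_map.2 (univ_mem' fun i => by simpa using hbound F l i))
    exact ⟨c, hc⟩
  choose Λ hΛ using hlim
  have hex : ∀ F : StrongDual ℝ Y, ∃ b : Lp ℝ ∞ ν, ∀ l, Λ F l = pairing ν b l := by
    intro F
    refine exists_pairing_eq (LinearMap.mkContinuous
      { toFun := Λ F
        map_add' := fun l l' => tendsto_nhds_unique (hΛ F (l + l'))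
          (by simpa using (hΛ F l).add (hΛ F l'))
        map_smul' := fun c l => tendsto_nhds_unique (hΛ F (c • l))
          (by simpa using (hΛ F l).const_mul c) } ‖F‖ fun l => ?_)
    exact le_of_tendsto (hΛ F l).norm (Eventually.of_forall fun i => hbound F l i)
  choose E hE using hex
  refine ⟨{ toFun := E
            map_add' := fun F F' => ext_of_pairing fun l => ?_
            map_smul' := fun c F => ext_of_pairing fun l => ?_ }, fun F l => ?_⟩
  · rw [map_add, add_apply, ← hE, ← hE, ← hE]
    exact tendsto_nhds_unique (hΛ (F + F') l) ((hΛ F l).add (hΛ F' l))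
  · rw [RingHom.id_apply, map_smul, smul_apply, ← hE, ← hE]
    exact tendsto_nhds_unique (hΛ (c • F) l) ((hΛ F l).const_mul c)
  · change Tendsto _ _ (𝓝 (pairing ν (E F) l))
    rw [← hE]
    exact hΛ F l

/-- An asymptotically equivariant net of Borel maps yields an equivariant conditional
expectation. -/
theorem isAmenable_of_asymptoticallyEquivariant [SigmaFinite ν] [IsMeasurableAction G ν]
    [η.IsHaarMeasure] {ι : Type*} [Preorder ι] [IsDirectedOrder ι] [Nonempty ι]
    {μ : ι → X → Lp ℝ 1 η} (hμ : ∀ i, IsBorelMap η (μ i))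
    (h : AsymptoticallyEquivariant ν η μ) : IsAmenable ν η := by
  let 𝒰 : Ultrafilter ι := Ultrafilter.of atTop
  have h𝒰 : (𝒰 : Filter ι) ≤ atTop := Ultrafilter.of_le _
  obtain ⟨E, hE⟩ := exists_ultrafilter_limit 𝒰 (fun i => borelMul ν (hμ i))
    fun i => norm_borelMul_le (hμ i)
  refine ⟨E, ⟨?_, ?_, ?_, ?_⟩⟩
  · have hb : MemLp (fun _ : X => (1 : ℝ)) ∞ ν := memLp_top_const 1
    have h1 : E (tensorOne ν η) = hb.toLp _ := by
      refine ext_of_pairing fun l => ?_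
      refine tendsto_nhds_unique (hE (tensorOne ν η) l) ?_
      have h2 : ∀ i, tensorOne ν η (borelMul ν (hμ i) l) = pairing ν (hb.toLp _) l := by
        intro i
        rw [tensorOne_apply, fiberIntegral_borelMul, pairing_apply]
        refine integral_congr_ae ?_
        filter_upwards [hb.coeFn_toLp] with x hx
        rw [hx, one_mul]
      simp_rw [h2]
      exact tendsto_const_nhds
    rw [h1]
    exact hb.coeFn_toLp
  · intro F hF
    exact nonneg_of_pairing fun l hl => ge_of_tendsto' (hE F l) fun i =>
      hF _ (borelMul_nonneg (hμ i) hl)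
  · intro a F
    have h1 : E (tensorMul a F) = a • E F := by
      refine ext_of_pairing fun l => ?_
      -- Each `borelMul` commutes with multiplication by `a`, so the module property passes to the
      -- limit.
      have h2 := hE F (topSmul ℝ a l)
      simp_rw [← topSmul_borelMul, ← tensorMul_apply] at h2
      rw [tendsto_nhds_unique (hE (tensorMul a F) l) h2, pairing_topSmul, pairing_apply]
      refine integral_congr_ae ?_
      filter_upwards [Lp.coeFn_lpSMul (r := ∞) a (E F)] with x hx
      rw [hx, Pi.smul_apply', smul_eq_mul]
    rw [h1]
    exact Lp.coeFn_lpSMul a (E F)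
  · intro g F
    have hb : MemLp (fun x => E F (g⁻¹ • x)) ∞ ν :=
      memLp_top_of_bound ((Lp.memLp (E F)).1.comp_quasiMeasurePreserving (quasi_of_action ν g⁻¹))
        ‖E F‖ ((quasi_of_action ν g⁻¹).ae (ae_norm_le_norm_Lp_top (E F)))
    have h1 : E (tensorTranslate ν η g F) = hb.toLp _ := by
      refine ext_of_pairing fun l => ?_
      refine tendsto_nhds_unique (hE (tensorTranslate ν η g F) l) ?_
      -- Inside `F`, `M_i U(g⁻¹) l` may be replaced by `P(g⁻¹) M_i l`, since their difference tends
      -- to 0; the adjoint of `P(g⁻¹)` is the translation of `F` by `g`.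
      have h2 := (hE F (translate G ν ℝ g⁻¹ l)).add
        ((F.continuous.tendsto 0).comp ((h.tendsto hμ g⁻¹ l).mono_left h𝒰))
      rw [map_zero, add_zero, pairing_apply, integral_mul_translate] at h2
      rw [pairing_apply, integral_congr_ae (g := fun x => E F (g⁻¹ • x) * l x) (by
        filter_upwards [hb.coeFn_toLp] with x hx
        rw [hx])]
      refine h2.congr fun i => ?_
      simp only [Function.comp_apply, map_sub, add_sub_cancel, predualRep_apply, inv_inv]
      rfl
    rw [h1]
    exact hb.coeFn_toLp

end BorelMap

/-! ### Disintegration of positive elements of `L₁(X; L₁(G))` -/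

/-- Used twice in a row, for `L₁(G)` and then for `L₁(X; L₁(G))`, to make the positive elements
there a convex cone. -/
theorem isOrderedModule_Lp {α E : Type*} [MeasurableSpace α] {μ : Measure α}
    [NormedAddCommGroup E] [NormedSpace ℝ E] [PartialOrder E] [IsOrderedAddMonoid E]
    [IsOrderedModule ℝ E] : IsOrderedModule ℝ (Lp E 1 μ) :=
  IsOrderedModule.of_smul_nonneg fun c hc f hf => by
    rw [← Lp.coeFn_nonneg] at hf ⊢
    filter_upwards [hf, Lp.coeFn_smul c f] with x h1 h2
    rw [h2]
    exact smul_nonneg hc h1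

section Disintegration

variable {X : Type u} {G : Type v} [Group G] [TopologicalSpace G] [IsTopologicalGroup G]
  [MeasurableSpace G] [BorelSpace G] [TopologicalSpace X] [MeasurableSpace X] [BorelSpace X]
  [MulAction G X] {ν : Measure X} {η : Measure G}

theorem exists_averaging_function [LocallyCompactSpace G] [η.IsHaarMeasure] :
    ∃ f : G → ℝ, Continuous f ∧ HasCompactSupport f ∧ (∀ h, 0 ≤ f h) ∧ ∫ h, f h ∂η = 1 := by
  obtain ⟨f, hfs, hf0, hf1⟩ := exists_continuous_nonneg_pos (1 : G)
  have hpos := f.continuous.integral_pos_of_hasCompactSupport_nonneg_nonzero (μ := η) hfs hf0 hf1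
  refine ⟨fun h => (∫ h, f h ∂η)⁻¹ * f h, by fun_prop, hfs.mul_left,
    fun h => mul_nonneg (inv_nonneg.2 hpos.le) (hf0 h), ?_⟩
  rw [integral_const_mul, inv_mul_cancel₀ hpos.ne']

theorem probDensity_nonempty [LocallyCompactSpace G] [η.IsHaarMeasure] :
    (ProbDensity η).Nonempty := by
  obtain ⟨f, hf, hfs, hf0, hf1⟩ := exists_averaging_function (η := η)
  have hm : MemLp f 1 η := hf.memLp_of_hasCompactSupport hfs
  refine ⟨hm.toLp f, ?_, ?_⟩
  · rw [← Lp.coeFn_nonneg]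
    filter_upwards [hm.coeFn_toLp] with h hh
    rw [hh]
    exact hf0 h
  · rw [integral_congr_ae hm.coeFn_toLp, hf1]

/-- A positive element `ζ` of `L₁(X; L₁(G))` is of the form `c μ`, where `c` is the fibre integral
of `ζ` and `μ` is a Borel map into `ℙ₀(G)`. -/
theorem exists_borelMul_fiberIntegral_eq [LocallyCompactSpace G] [η.IsHaarMeasure]
    {ζ : TensorPredual ν η} (hζ : 0 ≤ ζ) :
    ∃ (μ : X → Lp ℝ 1 η) (hμ : IsBorelMap η μ), borelMul ν hμ (fiberIntegral ν η ζ) = ζ := by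
  classical
  obtain ⟨p, hp⟩ := probDensity_nonempty (η := η)
  have hz := Lp.stronglyMeasurable ζ
  have hs : MeasurableSet {x | 0 ≤ ζ x ∧ ζ x ≠ 0} := by
    borelize ↥(Lp ℝ 1 η)
    exact (hz.measurable isClosed_nonneg.measurableSet).inter
      (hz.measurable isClosed_singleton.measurableSet).compl
  -- For positive elements of `L₁(G)` norm and integral agree, so division by the norm lands in
  -- `ℙ₀(G)`. The filler `p` is used only where `ζ x = 0`, so that the coefficient vanishes, and on
  -- a null set.
  have hμ : IsBorelMap η fun x => if 0 ≤ ζ x ∧ ζ x ≠ 0 then ‖ζ x‖⁻¹ • ζ x else p := by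
    refine ⟨StronglyMeasurable.ite hs (hz.norm.inv₀.smul hz) stronglyMeasurable_const,
      fun x => ?_⟩
    split_ifs with hx
    · refine ⟨Lp_smul_nonneg (by positivity) hx.1, ?_⟩
      rw [integral_congr_ae (Lp.coeFn_smul _ _)]
      simp only [Pi.smul_apply, smul_eq_mul]
      rw [integral_const_mul, ← norm_eq_integral_of_nonneg hx.1,
        inv_mul_cancel₀ (norm_ne_zero_iff.2 hx.2)]
    · exact hp
  refine ⟨_, hμ, Lp.ext ?_⟩
  filter_upwards [borelMul_coeFn hμ (fiberIntegral ν η ζ), fiberIntegral_coeFn ζ,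
    (Lp.coeFn_nonneg ζ).2 hζ] with x h1 h2 h3
  rw [h1, h2, ← norm_eq_integral_of_nonneg h3]
  by_cases hx : ζ x = 0
  · simp [hx]
  · rw [if_pos ⟨h3, hx⟩, smul_smul, mul_inv_cancel₀ (norm_ne_zero_iff.2 hx), one_smul]

/-- An element of `L₁` dominated by `k` is a bounded multiple of `k`. -/
theorem exists_topSmul_eq {l k : Lp ℝ 1 ν} (h : |l| ≤ k) :
    ∃ a : Lp ℝ ∞ ν, topSmul ℝ a k = l := by
  have h' : ∀ᵐ x ∂ν, |l x| ≤ k x := by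
    filter_upwards [(Lp.coeFn_le _ _).2 h, Lp.coeFn_abs l] with x h1 h2
    rwa [h2] at h1
  have hb : ∀ᵐ x ∂ν, ‖l x / k x‖ ≤ 1 := by
    filter_upwards [h'] with x hx
    rw [norm_div, Real.norm_eq_abs, Real.norm_eq_abs]
    exact div_le_one_of_le₀ (hx.trans (le_abs_self _)) (abs_nonneg _)
  have hm : MemLp (fun x => l x / k x) ∞ ν := memLp_top_of_bound
    ((Lp.stronglyMeasurable l).measurable.div
      (Lp.stronglyMeasurable k).measurable).aestronglyMeasurable 1 hb
  refine ⟨hm.toLp _, Lp.ext ?_⟩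
  filter_upwards [topSmul_coeFn (hm.toLp _) k, hm.coeFn_toLp, h'] with x h1 h2 h3
  rw [h1, h2, smul_eq_mul]
  by_cases hx : k x = 0
  · rw [hx, mul_zero, eq_comm, ← abs_nonpos_iff]
    rwa [hx] at h3
  · exact div_mul_cancel₀ _ hx

theorem fiberIntegral_topSmul (a : Lp ℝ ∞ ν) (k : TensorPredual ν η) :
    fiberIntegral ν η (topSmul _ a k) = topSmul ℝ a (fiberIntegral ν η k) := by
  refine Lp.ext ?_
  filter_upwards [fiberIntegral_coeFn (topSmul _ a k), topSmul_coeFn a k, fiberIntegral_coeFn k,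
    topSmul_coeFn a (fiberIntegral ν η k)] with x h1 h2 h3 h4
  rw [h1, h2, h4, h3, integral_congr_ae (Lp.coeFn_smul _ _)]
  simp only [Pi.smul_apply, smul_eq_mul]
  rw [integral_const_mul]

theorem exists_pos_Lp_one (ν : Measure X) [SigmaFinite ν] :
    ∃ k : Lp ℝ 1 ν, 0 ≤ k ∧ ∀ᵐ x ∂ν, 0 < k x := by
  obtain ⟨w, hw0, hw, hwint⟩ := exists_pos_lintegral_lt_of_sigmaFinite ν one_ne_zero
  have hm : MemLp (fun x => (w x : ℝ)) 1 ν := by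
    refine ⟨hw.coe_nnreal_real.aestronglyMeasurable, ?_⟩
    rw [eLpNorm_one_eq_lintegral_enorm]
    refine lt_of_le_of_lt (lintegral_mono fun x => ?_) (hwint.trans_le le_top)
    simp
  have h1 : ∀ᵐ x ∂ν, 0 < hm.toLp _ x := by
    filter_upwards [hm.coeFn_toLp] with x hx
    rw [hx]
    exact_mod_cast hw0 x
  refine ⟨hm.toLp _, ?_, h1⟩
  rw [← Lp.coeFn_nonneg]
  filter_upwards [h1] with x hx using hx.le

/-- A positive `L∞(X)`-linear right inverse of the fibre integral is given by a Borel map. -/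
theorem exists_eq_borelMul [LocallyCompactSpace G] [η.IsHaarMeasure] [SigmaFinite ν]
    (Q : Lp ℝ 1 ν →L[ℝ] TensorPredual ν η) (hQ0 : ∀ l, 0 ≤ l → 0 ≤ Q l)
    (hQ1 : ∀ l, fiberIntegral ν η (Q l) = l)
    (hQ : ∀ a l, topSmul _ a (Q l) = Q (topSmul ℝ a l)) :
    ∃ (μ : X → Lp ℝ 1 η) (hμ : IsBorelMap η μ), Q = borelMul ν hμ := by
  obtain ⟨k, hk, hkpos⟩ := exists_pos_Lp_one ν
  obtain ⟨μ, hμ, h1⟩ := exists_borelMul_fiberIntegral_eq (hQ0 k hk)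
  rw [hQ1] at h1
  refine ⟨μ, hμ, ContinuousLinearMap.ext fun l => ?_⟩
  -- The element `k + |l|` dominates both `k` and `l`. Its Borel map `μ'` therefore computes `Q k`
  -- and `Q l` by linearity over `L∞(X)`, and it agrees almost everywhere with `μ` because `k > 0`.
  have hk1 : 0 ≤ k + |l| := add_nonneg hk (abs_nonneg l)
  obtain ⟨μ', hμ', h2⟩ := exists_borelMul_fiberIntegral_eq (hQ0 _ hk1)
  rw [hQ1] at h2
  obtain ⟨a, ha⟩ := exists_topSmul_eq (l := k) (k := k + |l|)
    (by rw [abs_of_nonneg hk]; exact le_add_of_nonneg_right (abs_nonneg l))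
  obtain ⟨c, hc⟩ := exists_topSmul_eq (l := l) (k := k + |l|) (le_add_of_nonneg_left hk)
  have h3 : borelMul ν hμ k = borelMul ν hμ' k := by
    rw [h1, ← ha, ← hQ, ← h2, topSmul_borelMul]
  have h4 : μ =ᵐ[ν] μ' := by
    filter_upwards [borelMul_coeFn hμ k, borelMul_coeFn hμ' k, hkpos] with x h5 h6 h7
    rw [h3, h6] at h5
    exact (smul_right_injective _ h7.ne' h5).symm
  have h5 : Q l = borelMul ν hμ' l := by
    rw [← hc, ← hQ, ← h2, topSmul_borelMul]
  rw [h5]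
  refine Lp.ext ?_
  filter_upwards [borelMul_coeFn hμ l, borelMul_coeFn hμ' l, h4] with x h6 h7 h8
  rw [h6, h7, h8]

end Disintegration

/-! ### From a conditional expectation to approximately equivariant Borel maps -/

/-- If every continuous functional which is nonpositive on `A '' C` is nonpositive at `p`, then
`p` is in the closure of `A '' C`. -/
theorem mem_closure_image_of_forall_dual {Y W : Type*} [NormedAddCommGroup Y] [NormedSpace ℝ Y]
    [NormedAddCommGroup W] [NormedSpace ℝ W] (A : Y →L[ℝ] W) {C : Set Y} (hC : Convex ℝ C)
    (h0 : 0 ∈ C) (hsmul : ∀ y ∈ C, ∀ c : ℝ, 0 ≤ c → c • y ∈ C) {p : W}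
    (h : ∀ f : StrongDual ℝ W, (∀ y ∈ C, f (A y) ≤ 0) → f p ≤ 0) : p ∈ closure (A '' C) := by
  by_contra hp
  obtain ⟨f, c, hf, hfp⟩ := geometric_hahn_banach_closed_point
    (hC.linear_image A.toLinearMap).closure isClosed_closure hp
  have hc : ∀ y ∈ C, f (A y) < c := fun y hy => hf _ (subset_closure ⟨y, hy, rfl⟩)
  have hc0 : 0 < c := by simpa using hc 0 h0
  -- On a cone the separating functional cannot be positive anywhere, or scaling would reach the
  -- bound `c`.
  refine (h f fun y hy => ?_).not_gt (hc0.trans hfp)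
  by_contra! hpos
  have h1 := hc _ (hsmul y hy (c / f (A y)) (by positivity))
  rw [map_smul, map_smul, smul_eq_mul, div_mul_cancel₀ _ hpos.ne'] at h1
  exact h1.false

section CondExp

variable {X : Type u} {G : Type v} [Group G] [TopologicalSpace G] [IsTopologicalGroup G]
  [MeasurableSpace G] [BorelSpace G] [TopologicalSpace X] [MeasurableSpace X] [BorelSpace X]
  [MulAction G X] {ν : Measure X} [SigmaFinite ν] [IsMeasurableAction G ν]
  {η : Measure G} [η.IsHaarMeasure]

theorem tensorMul_tensorOne_apply (b : Lp ℝ ∞ ν) (ζ : TensorPredual ν η) :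
    tensorMul b (tensorOne ν η) ζ = pairing ν b (fiberIntegral ν η ζ) := by
  rw [tensorMul_apply, tensorOne_apply, fiberIntegral_topSmul, pairing_apply]
  refine integral_congr_ae ?_
  filter_upwards [topSmul_coeFn b (fiberIntegral ν η ζ)] with x hx
  rw [hx, smul_eq_mul]

namespace IsEquivariantCondExp

variable {E : LinftyTensor ν η →ₗ[ℝ] Lp ℝ ∞ ν} (hE : IsEquivariantCondExp ν η E)

include hE

theorem pairing_tensorMul_tensorOne (b : Lp ℝ ∞ ν) (l : Lp ℝ 1 ν) :
    pairing ν (E (tensorMul b (tensorOne ν η))) l = pairing ν b l := by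
  congr 2
  refine Lp.ext ?_
  filter_upwards [hE.linear b (tensorOne ν η), hE.unital] with x h1 h2
  rw [h1, h2, mul_one]

theorem pairing_tensorMul (a : Lp ℝ ∞ ν) (F : LinftyTensor ν η) (k : Lp ℝ 1 ν) :
    pairing ν (E (tensorMul a F)) k = pairing ν (E F) (topSmul ℝ a k) := by
  rw [pairing_topSmul, pairing_apply]
  refine integral_congr_ae ?_
  filter_upwards [hE.linear a F] with x hx
  rw [hx]

theorem pairing_tensorTranslate (g : G) (F : LinftyTensor ν η) (l : Lp ℝ 1 ν) :
    pairing ν (E (tensorTranslate ν η g⁻¹ F)) l = pairing ν (E F) (translate G ν ℝ g l) := by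
  rw [pairing_apply, pairing_apply, integral_mul_translate]
  refine integral_congr_ae ?_
  filter_upwards [hE.equivariant g⁻¹ F] with x hx
  rw [hx, inv_inv]

/-- Writing `l` and its translate as multiples of a single `k` lets one functional `F ↦ ⟨E F, k⟩`
encode equivariance for several pairs `(g, l)` at once. -/
theorem pairing_comp_sub_eq_zero (g : G) {a c : Lp ℝ ∞ ν} {k l : Lp ℝ 1 ν}
    (ha : topSmul ℝ a k = l) (hc : topSmul ℝ c k = translate G ν ℝ g l) (F : LinftyTensor ν η) :
    pairing ν (E (F.comp ((predualRep ν η g).comp (topSmul _ a) - topSmul _ c))) k = 0 := by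
  have h1 : F.comp ((predualRep ν η g).comp (topSmul _ a) - topSmul _ c)
      = tensorMul a (tensorTranslate ν η g⁻¹ F) - tensorMul c F := by
    ext ζ
    simp only [ContinuousLinearMap.comp_apply, sub_apply, map_sub]
    rfl
  rw [h1, map_sub, map_sub, sub_apply, hE.pairing_tensorMul, hE.pairing_tensorMul, ha, hc,
    hE.pairing_tensorTranslate, sub_self]

/-- If the functionals `F ∘ D_t` have conditional expectations which vanish on `k`, then `k` can be
approximated by fibre integrals of positive elements `ζ` for which all `D_t ζ` are small. -/
theorem exists_nonneg_approx {T : Type*} [Fintype T]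
    (D : T → TensorPredual ν η →L[ℝ] TensorPredual ν η) {k : Lp ℝ 1 ν} (hk : 0 ≤ k)
    (hD : ∀ t (F : LinftyTensor ν η), pairing ν (E (F.comp (D t))) k = 0) {ε : ℝ} (hε : 0 < ε) :
    ∃ ζ : TensorPredual ν η, 0 ≤ ζ ∧ (∀ t, ‖D t ζ‖ < ε) ∧ ‖fiberIntegral ν η ζ - k‖ < ε := by
  classical
  have := isOrderedModule_Lp (E := ℝ) (μ := η)
  have := isOrderedModule_Lp (E := Lp ℝ 1 η) (μ := ν)
  have hmem : ((0, k) : (T → TensorPredual ν η) × Lp ℝ 1 ν) ∈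
      closure (((ContinuousLinearMap.pi D).prod (fiberIntegral ν η)) '' Ici 0) := by
    refine mem_closure_image_of_forall_dual _ (convex_Ici 0) self_mem_Ici
      (fun y hy r hr => smul_nonneg hr hy) fun f hf => ?_
    let F : T → LinftyTensor ν η := fun t =>
      (f.comp (ContinuousLinearMap.inl ℝ _ _)).comp
        (ContinuousLinearMap.single ℝ (fun _ : T => TensorPredual ν η) t)
    obtain ⟨b, hb⟩ := exists_pairing_eq (f.comp (ContinuousLinearMap.inr ℝ _ _))
    have hsum : f.comp ((ContinuousLinearMap.pi D).prod (fiberIntegral ν η))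
        = ∑ t, (F t).comp (D t) + tensorMul b (tensorOne ν η) := by
      ext ζ
      rw [add_apply, tensorMul_tensorOne_apply, ← hb]
      simp only [ContinuousLinearMap.comp_apply, sum_apply, F, ← map_sum, ← map_add]
      congr 1
      refine Prod.ext ?_ (by simp [Prod.snd_sum])
      ext1 t
      simp [Prod.fst_sum, Finset.sum_apply, Pi.single_apply]
    -- A separating functional has components `F t` and `b`. Positivity of `E`, paired with `k`,
    -- bounds the sum of the `⟨E (F t ∘ D t), k⟩` and `⟨b, k⟩` by 0; the first terms vanish by
    -- assumption and `E(b 1) = b`, so the value at `(0, k)` is nonpositive.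
    have hneg : TensorNonneg (-f.comp ((ContinuousLinearMap.pi D).prod (fiberIntegral ν η))) :=
      fun ζ hζ => neg_nonneg.2 (hf ζ hζ)
    have h1 := pairing_nonneg (hE.nonneg _ hneg) hk
    rw [hsum, map_neg, map_neg, neg_apply, map_add, map_add, add_apply, map_sum, map_sum,
      sum_apply, hE.pairing_tensorMul_tensorOne,
      Finset.sum_eq_zero fun t _ => hD t (F t),
      zero_add, ← hb] at h1
    exact neg_nonneg.1 h1
  obtain ⟨_, ⟨ζ, hζ, rfl⟩, hdist⟩ := Metric.mem_closure_iff.1 hmem ε hε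
  rw [dist_comm, dist_eq_norm, Prod.norm_def, max_lt_iff] at hdist
  refine ⟨ζ, hζ, fun t => lt_of_le_of_lt ?_ hdist.1, hdist.2⟩
  have h := norm_le_pi_norm (fun t => D t ζ) t
  exact h.trans_eq (by simp)

/-- An equivariant conditional expectation yields Borel maps which are almost equivariant with
respect to finitely many group elements and densities. -/
theorem exists_borelMap [LocallyCompactSpace G] (T : Finset (G × Lp ℝ 1 ν)) {ε : ℝ} (hε : 0 < ε) :
    ∃ (μ : X → Lp ℝ 1 η) (hμ : IsBorelMap η μ), ∀ t ∈ T,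
      ‖predualRep ν η t.1 (borelMul ν hμ t.2) - borelMul ν hμ (translate G ν ℝ t.1 t.2)‖ < ε := by
  classical
  obtain ⟨k, hk, hkt⟩ : ∃ k : Lp ℝ 1 ν, 0 ≤ k ∧
      ∀ t ∈ T, |t.2| + |translate G ν ℝ t.1 t.2| ≤ k :=
    ⟨∑ t ∈ T, (|t.2| + |translate G ν ℝ t.1 t.2|), Finset.sum_nonneg fun t _ => by positivity,
      fun t ht => Finset.single_le_sum
        (f := fun t : G × Lp ℝ 1 ν => |t.2| + |translate G ν ℝ t.1 t.2|)
        (fun t _ => by positivity) ht⟩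
  have ha : ∀ t : T, ∃ a : Lp ℝ ∞ ν, topSmul ℝ a k = t.1.2 := fun t =>
    exists_topSmul_eq ((le_add_of_nonneg_right (abs_nonneg _)).trans (hkt t.1 t.2))
  have hc : ∀ t : T, ∃ c : Lp ℝ ∞ ν, topSmul ℝ c k = translate G ν ℝ t.1.1 t.1.2 := fun t =>
    exists_topSmul_eq ((le_add_of_nonneg_left (abs_nonneg _)).trans (hkt t.1 t.2))
  choose a ha using ha
  choose c hc using hc
  let D : T → TensorPredual ν η →L[ℝ] TensorPredual ν η := fun t =>
    (predualRep ν η t.1.1).comp (topSmul _ (a t)) - topSmul _ (c t)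
  have hD : ∀ t {μ : X → Lp ℝ 1 η} (hμ : IsBorelMap η μ), D t (borelMul ν hμ k) =
      predualRep ν η t.1.1 (borelMul ν hμ t.1.2)
        - borelMul ν hμ (translate G ν ℝ t.1.1 t.1.2) := by
    intro t μ hμ
    simp only [D, sub_apply, ContinuousLinearMap.comp_apply, topSmul_borelMul, ha, hc]
  -- Replacing `ζ` by `k μ` moves it by at most `‖fiberIntegral ν η ζ - k‖`, an error that `D t`
  -- magnifies by at most `‖D t‖`; the 1 accounts for the norm of `D t ζ` itself.
  let S : ℝ := ∑ t, ‖D t‖ + 1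
  have hS : 0 < S := by positivity
  obtain ⟨ζ, hζ, hDζ, hkζ⟩ := hE.exists_nonneg_approx D hk
    (fun t F => hE.pairing_comp_sub_eq_zero t.1.1 (ha t) (hc t) F)
    (show 0 < ε / (2 * S) by positivity)
  obtain ⟨μ, hμ, hζμ⟩ := exists_borelMul_fiberIntegral_eq hζ
  refine ⟨μ, hμ, fun t ht => ?_⟩
  rw [← hD ⟨t, ht⟩ hμ]
  have h2 : ‖borelMul ν hμ k - ζ‖ ≤ ε / (2 * S) := by
    rw [← hζμ, ← map_sub, ← norm_neg, ← map_neg, neg_sub]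
    refine ((borelMul ν hμ).le_of_opNorm_le (norm_borelMul_le hμ) _).trans ?_
    rw [one_mul]
    exact hkζ.le
  have h3 : ‖D ⟨t, ht⟩‖ + 1 ≤ S :=
    add_le_add (Finset.single_le_sum (f := fun t => ‖D t‖) (fun t _ => norm_nonneg _)
      (Finset.mem_univ _)) le_rfl
  calc ‖D ⟨t, ht⟩ (borelMul ν hμ k)‖
      = ‖D ⟨t, ht⟩ (borelMul ν hμ k - ζ) + D ⟨t, ht⟩ ζ‖ := by rw [map_sub, sub_add_cancel]
    _ ≤ ‖D ⟨t, ht⟩‖ * (ε / (2 * S)) + ε / (2 * S) := by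
      refine (norm_add_le _ _).trans (add_le_add ?_ (hDζ _).le)
      exact (D ⟨t, ht⟩).le_opNorm_of_le h2
    _ = (‖D ⟨t, ht⟩‖ + 1) * (ε / (2 * S)) := by ring
    _ ≤ S * (ε / (2 * S)) := by gcongr
    _ = ε / 2 := by field_simp
    _ < ε := half_lt_self hε

end IsEquivariantCondExp

end CondExp

/-! ### Averages of Borel maps -/

section Average

variable {X : Type u} {G : Type v} [Group G] [TopologicalSpace G] [IsTopologicalGroup G]
  [MeasurableSpace G] [BorelSpace G] [TopologicalSpace X] [MeasurableSpace X] [BorelSpace X]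
  [MulAction G X] {ν : Measure X} [SigmaFinite ν] [IsMeasurableAction G ν]
  {η : Measure G} [η.IsHaarMeasure] {μ : X → Lp ℝ 1 η}

variable [LocallyCompactSpace G] [T2Space G]

theorem isBorelMap_twist (ν : Measure X) [IsMeasurableAction G ν] (hμ : IsBorelMap η μ) (h : G) :
    IsBorelMap η fun x => leftTranslate η h (μ (h⁻¹ • x)) where
  stronglyMeasurable := (leftTranslate η h).continuous.comp_stronglyMeasurable
    (hμ.stronglyMeasurable.comp_measurable (measurable_smul_of_action ν h⁻¹))
  mem _ := ⟨leftTranslate_nonneg η h (hμ.mem _).1,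
    (integral_leftTranslate η h _).trans (hμ.mem _).2⟩

/-- Conjugating by the two representations stays within the maps given by Borel maps: the
Radon-Nikodym factors cancel. -/
theorem twist_borelMul (hμ : IsBorelMap η μ) (h : G) :
    twist (translate G ν ℝ) (predualRep ν η) (borelMul ν hμ) h
      = borelMul ν (isBorelMap_twist ν hμ h) := by
  ext1 l
  refine Lp.ext ?_
  have h1 : translate G ν ℝ h (translate G ν ℝ h⁻¹ l) = l := by
    rw [← mul_apply_eq_comp, ← map_mul, mul_inv_cancel, map_one, one_apply_eq_self]
  have h2 := translate_coeFn ν h (translate G ν ℝ h⁻¹ l)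
  rw [h1] at h2
  filter_upwards [predualRep_coeFn ν η h (borelMul ν hμ (translate G ν ℝ h⁻¹ l)),
    (quasi_of_action ν h⁻¹).ae (borelMul_coeFn hμ (translate G ν ℝ h⁻¹ l)),
    borelMul_coeFn (isBorelMap_twist ν hμ h) l, h2] with x h3 h4 h5 h6
  rw [twist_apply, h3, h4, h5, h6, map_smul, smul_smul]
  rfl

variable [T2Space X] [ν.Regular] [η.Regular]

/-- Averages of `h μ(h⁻¹ x)` over `h` are given by Borel maps. -/
theorem exists_averageMap_eq_borelMul (hμ : IsBorelMap η μ) {f : G → ℝ} (hf : Continuous f)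
    (hfs : HasCompactSupport f) (hf0 : ∀ h, 0 ≤ f h) (hf1 : ∫ h, f h ∂η = 1) :
    ∃ (μ' : X → Lp ℝ 1 η) (hμ' : IsBorelMap η μ'),
      averageMap (U := translate G ν ℝ) (P := predualRep ν η) (norm_translate_le ν)
        (norm_predualRep_le ν η) (continuous_translate ν η)
        (continuous_predualRep ν η) η hf hfs (borelMul ν hμ) = borelMul ν hμ' := by
  have := isOrderedModule_Lp (E := ℝ) (μ := η)
  have := isOrderedModule_Lp (E := Lp ℝ 1 η) (μ := ν)
  have hint := integrable_smul_twist (U := translate G ν ℝ) (P := predualRep ν η)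
    (norm_translate_le ν) (norm_predualRep_le ν η)
    (continuous_translate ν η) (continuous_predualRep ν η) η hf hfs (borelMul ν hμ)
  -- Positivity, linearity over `L∞(X)` and the fibre integral survive averaging against a
  -- probability density. Recovering the Borel map from these properties avoids integrating over `h`
  -- pointwise in `x`.
  refine exists_eq_borelMul _ (fun l hl => ?_) (fun l => ?_) (fun a l => ?_)
  · rw [averageMap_apply]
    refine integral_nonneg fun h => ?_
    rw [twist_borelMul]
    exact smul_nonneg (hf0 h) (borelMul_nonneg _ hl)
  · rw [averageMap_apply, ← ContinuousLinearMap.integral_comp_comm _ (hint l)]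
    simp only [map_smul, twist_borelMul, fiberIntegral_borelMul]
    rw [integral_smul_const, hf1, one_smul]
  · rw [averageMap_apply, averageMap_apply, ← ContinuousLinearMap.integral_comp_comm _ (hint l)]
    simp only [map_smul, twist_borelMul, topSmul_borelMul]

/-- An amenable action has Borel maps which are almost equivariant, uniformly on compact
sets. -/
theorem IsAmenable.exists_borelMap (h : IsAmenable ν η) (m : Measure X) [IsFiniteMeasure m]
    (hm : m ≪ ν) {ε : ℝ} (hε : 0 < ε) {K : Set G} (hK : IsCompact K) :
    ∃ μ : X → Lp ℝ 1 η, IsBorelMap η μ ∧ defect η m K μ < ENNReal.ofReal ε := by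
  classical
  obtain ⟨E, hE⟩ := h
  obtain ⟨f, hf, hfs, hf0, hf1⟩ := exists_averaging_function (η := η)
  have hex : ∀ i : Finset (G × Lp ℝ 1 ν) × ℕ, ∃ (μ : X → Lp ℝ 1 η) (hμ : IsBorelMap η μ),
      ∀ t ∈ i.1, ‖predualRep ν η t.1 (borelMul ν hμ t.2)
        - borelMul ν hμ (translate G ν ℝ t.1 t.2)‖ < 1 / ((i.2 : ℝ) + 1) :=
    fun i => hE.exists_borelMap i.1 (by positivity)
  choose μ hμ hμi using hex
  have hlim : ∀ (h : G) (l : Lp ℝ 1 ν), Tendsto (fun i =>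
      twist (translate G ν ℝ) (predualRep ν η) (borelMul ν (hμ i)) h l - borelMul ν (hμ i) l)
      atTop (𝓝 0) := by
    intro h l
    have h1 : translate G ν ℝ h (translate G ν ℝ h⁻¹ l) = l := by
      rw [← mul_apply_eq_comp, ← map_mul, mul_inv_cancel, map_one, one_apply_eq_self]
    refine squeeze_zero_norm' (a := fun i : Finset (G × Lp ℝ 1 ν) × ℕ => 1 / ((i.2 : ℝ) + 1)) ?_ ?_
    -- The pair with second entry `U(h)⁻¹ l` is the relevant one: for it the intertwining error is
    -- `P(h) M U(h)⁻¹ l - M l`.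
    · filter_upwards [eventually_ge_atTop ({(h, translate G ν ℝ h⁻¹ l)}, 0)] with i hi
      have h2 := hμi i (h, translate G ν ℝ h⁻¹ l) (hi.1 (Finset.mem_singleton_self _))
      rw [h1] at h2
      exact h2.le
    · refine tendsto_one_div_add_atTop_nhds_zero_nat.comp ?_
      rw [← prod_atTop_atTop_eq]
      exact tendsto_snd
  obtain ⟨i, hi⟩ := (eventually_forall_norm_averageMap_sub_le (U := translate G ν ℝ)
    (P := predualRep ν η) (norm_translate_le ν)
    (norm_predualRep_le ν η) (continuous_translate ν η) (continuous_predualRep ν η) atTop _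
    (fun i => norm_borelMul_le (hμ i)) hlim η hf hfs hf0 hf1 hK (measureDensity ν m)
    (half_pos hε)).exists
  obtain ⟨μ', hμ', hQ⟩ := exists_averageMap_eq_borelMul (ν := ν) (hμ i) hf hfs hf0 hf1
  refine ⟨μ', hμ', lt_of_le_of_lt (iSup₂_le fun g hg => ?_)
    ((ENNReal.ofReal_lt_ofReal_iff hε).2 (half_lt_self hε))⟩
  rw [← enorm_predualRep_borelMul_measureDensity hμ' g hm, ← ofReal_norm, ← hQ]
  exact ENNReal.ofReal_le_ofReal (hi g hg)

end Average

/-! ### Asymptotically equivariant nets -/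

section Net

variable {X : Type u} {G : Type v} [Group G] [TopologicalSpace G] [IsTopologicalGroup G]
  [MeasurableSpace G] [BorelSpace G] [TopologicalSpace X] [MeasurableSpace X] [BorelSpace X]
  [MulAction G X] {ν : Measure X} {η : Measure G} [η.IsHaarMeasure]

theorem defect_mono {m m' : Measure X} (hm : m ≤ m') {K K' : Set G} (hK : K ⊆ K')
    (μ : X → Lp ℝ 1 η) : defect η m K μ ≤ defect η m' K' μ :=
  (iSup₂_mono fun _ _ => lintegral_mono' hm le_rfl).trans (biSup_mono fun _ hg => hK hg)

theorem defect_smul_measure (c : ℝ≥0∞) (m : Measure X) (K : Set G) (μ : X → Lp ℝ 1 η) :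
    defect η (c • m) K μ = c * defect η m K μ := by
  simp [defect, ENNReal.mul_iSup]

variable (G ν) in
/-- Pairs of a finite measure on `X` absolutely continuous with respect to `ν` and a compact
subset of `G`. -/
def NetIndex : Type (max u v) :=
  {p : Measure X × Set G // (IsFiniteMeasure p.1 ∧ p.1 ≪ ν) ∧ IsCompact p.2}

instance : PartialOrder (NetIndex G ν) :=
  inferInstanceAs (PartialOrder {p : Measure X × Set G //
    (IsFiniteMeasure p.1 ∧ p.1 ≪ ν) ∧ IsCompact p.2})

instance : Nonempty (NetIndex G ν) :=
  ⟨⟨(0, ∅), ⟨inferInstance, Measure.AbsolutelyContinuous.zero _⟩, isCompact_empty⟩⟩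

instance : IsDirectedOrder (NetIndex G ν) where
  directed p q := by
    obtain ⟨⟨m, K⟩, ⟨hm, hmν⟩, hK⟩ := p
    obtain ⟨⟨m', K'⟩, ⟨hm', hmν'⟩, hK'⟩ := q
    refine ⟨⟨(m + m', K ∪ K'), ⟨?_, hmν.add_left hmν'⟩, hK.union hK'⟩, ?_, ?_⟩
    · dsimp only at hm hm' ⊢
      infer_instance
    · exact ⟨Measure.le_add_right le_rfl, subset_union_left⟩
    · exact ⟨Measure.le_add_left le_rfl, subset_union_right⟩

/-- The defect is homogeneous in the measure, so a finite measure is normalised and its total mass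
is put into `ε`. -/
theorem exists_defect_lt_one [LocallyCompactSpace G]
    (h : ∀ m : Measure X, IsProbabilityMeasure m → m ≪ ν → ∀ ε : ℝ, 0 < ε →
      ∀ K : Set G, IsCompact K →
        ∃ μ : X → Lp ℝ 1 η, IsBorelMap η μ ∧ defect η m K μ < ENNReal.ofReal ε)
    {m : Measure X} [IsFiniteMeasure m] (hm : m ≪ ν) {K : Set G} (hK : IsCompact K) :
    ∃ μ : X → Lp ℝ 1 η, IsBorelMap η μ ∧ defect η m K μ < 1 := by
  rcases eq_zero_or_neZero m with rfl | hm0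
  · obtain ⟨p, hp⟩ := probDensity_nonempty (η := η)
    exact ⟨fun _ => p, ⟨stronglyMeasurable_const, fun _ => hp⟩, by simp [defect]⟩
  have hne : m univ ≠ 0 := by simpa using hm0.out
  have hpos : 0 < (m univ).toReal := ENNReal.toReal_pos hne (measure_ne_top m _)
  obtain ⟨μ, hμ, hd⟩ := h ((m univ)⁻¹ • m) inferInstance
    (Measure.AbsolutelyContinuous.smul_left hm _) (m univ).toReal⁻¹ (inv_pos.2 hpos) K hK
  refine ⟨μ, hμ, ?_⟩
  rw [defect_smul_measure, ENNReal.ofReal_inv_of_pos hpos,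
    ENNReal.ofReal_toReal (measure_ne_top m _)] at hd
  have h1 := (ENNReal.mul_lt_mul_iff_right hne (measure_ne_top m _)).2 hd
  rwa [← mul_assoc, ENNReal.mul_inv_cancel hne (measure_ne_top m _), one_mul] at h1

/-- The tolerance `ε` is absorbed into the measure: defect below 1 for `ε⁻¹ m` means defect below
`ε` for `m`. Indexing by all finite measures, instead of probability measures, permits this and
makes the index set directed under sums. -/
theorem exists_asymptoticallyEquivariant [LocallyCompactSpace G]
    (h : ∀ m : Measure X, IsProbabilityMeasure m → m ≪ ν → ∀ ε : ℝ, 0 < ε →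
      ∀ K : Set G, IsCompact K →
        ∃ μ : X → Lp ℝ 1 η, IsBorelMap η μ ∧ defect η m K μ < ENNReal.ofReal ε) :
    ∃ μ : NetIndex G ν → X → Lp ℝ 1 η, (∀ i, IsBorelMap η (μ i)) ∧
      AsymptoticallyEquivariant ν η μ := by
  have hex : ∀ i : NetIndex G ν, ∃ μ : X → Lp ℝ 1 η, IsBorelMap η μ ∧
      defect η i.1.1 i.1.2 μ < 1 := fun i => by
    have := i.2.1.1
    exact exists_defect_lt_one h i.2.1.2 i.2.2
  choose μ hμ hd using hex
  refine ⟨μ, hμ, fun m hm hmν ε hε K hK => ?_⟩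
  have hε0 : ENNReal.ofReal ε ≠ 0 := by simpa using hε
  have hfin : IsFiniteMeasure ((ENNReal.ofReal ε)⁻¹ • m) :=
    Measure.smul_finite m (ENNReal.inv_ne_top.2 hε0)
  refine ⟨⟨((ENNReal.ofReal ε)⁻¹ • m, K),
    ⟨hfin, Measure.AbsolutelyContinuous.smul_left hmν _⟩, hK⟩, fun i hi => ?_⟩
  have h1 := (defect_mono hi.1 hi.2 (μ i)).trans_lt (hd i)
  dsimp only at h1
  rw [defect_smul_measure] at h1
  have h2 := (ENNReal.mul_lt_mul_iff_right hε0 ENNReal.ofReal_ne_top).2 h1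
  rwa [← mul_assoc, ENNReal.mul_inv_cancel hε0 ENNReal.ofReal_ne_top, one_mul, mul_one] at h2

end Net

end

end AmenableAction

-- The equivalences

theorem mainTheorem8 {X : Type u} {G : Type v}
    [Group G] [TopologicalSpace G] [IsTopologicalGroup G] [LocallyCompactSpace G] [T2Space G]
    [MeasurableSpace G] [BorelSpace G]
    [TopologicalSpace X] [LocallyCompactSpace X] [T2Space X] [MeasurableSpace X] [BorelSpace X]
    [MulAction G X]
    (ν : Measure X) [SigmaFinite ν] [ν.Regular] [AmenableAction.IsMeasurableAction G ν]
    (η : Measure G) [η.IsHaarMeasure] [η.Regular] :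
    (AmenableAction.IsAmenable ν η ↔
      ∀ m : Measure X, IsProbabilityMeasure m → m ≪ ν → ∀ ε : ℝ, 0 < ε →
        ∀ K : Set G, IsCompact K →
          ∃ μ : X → Lp ℝ 1 η, AmenableAction.IsBorelMap η μ ∧
            AmenableAction.defect η m K μ < ENNReal.ofReal ε) ∧
    (AmenableAction.IsAmenable ν η ↔
      ∃ (ι : Type (max u v)) (_ : Preorder ι) (_ : IsDirectedOrder ι) (_ : Nonempty ι)
        (μ : ι → X → Lp ℝ 1 η), (∀ i, AmenableAction.IsBorelMap η (μ i)) ∧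
          AmenableAction.AsymptoticallyEquivariant ν η μ) := by
  have h12 := fun (h : AmenableAction.IsAmenable ν η) (m : Measure X)
    (_ : IsProbabilityMeasure m) (hm : m ≪ ν) (ε : ℝ) (hε : 0 < ε) (K : Set G)
    (hK : IsCompact K) => h.exists_borelMap m hm hε hK
  have h31 : (∃ (ι : Type (max u v)) (_ : Preorder ι) (_ : IsDirectedOrder ι) (_ : Nonempty ι)
      (μ : ι → X → Lp ℝ 1 η), (∀ i, AmenableAction.IsBorelMap η (μ i)) ∧
        AmenableAction.AsymptoticallyEquivariant ν η μ) → AmenableAction.IsAmenable ν η := by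
    rintro ⟨ι, _, _, _, μ, hμ, h⟩
    exact AmenableAction.isAmenable_of_asymptoticallyEquivariant hμ h
  refine ⟨⟨h12, fun h => h31 ?_⟩, ⟨fun h => ?_, h31⟩⟩
  · exact ⟨AmenableAction.NetIndex G ν, inferInstance, inferInstance, inferInstance,
      AmenableAction.exists_asymptoticallyEquivariant h⟩
  · exact ⟨AmenableAction.NetIndex G ν, inferInstance, inferInstance, inferInstance,
      AmenableAction.exists_asymptoticallyEquivariant (h12 h)⟩
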